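/- All graphs are finite and simple. For a graph $G=(V,E)$, let $\mathrm{SSP}(G)\subseteq\mathbb{R}^{V}$ be its stable set polytope, that is, the convex hull of the incidence vectors of the stable sets (sets of pairwise non-adjacent vertices) of $G$. Let $\mathrm{TSTAB}(G)$ be the set of all $x\in\mathbb{R}^{V}$ such that (a) $0\le x_v\le 1$ for every vertex $v$ of $G$; (b) $x_u+x_v\le 1$ for every edge $uv$ of $G$; (c) $\sum_{v\in V(C)}x_v\le \frac{|V(C)|-1}{2}$ for every odd cycle $C$ of $G$. (The upper bound in (a) matters only for isolated vertices.) The graph $G$ is called t-perfect if $\mathrm{SSP}(G)=\mathrm{TSTAB}(G)$. **Theorem.** Every t-perfect graph is $199053$-colourable, that is, its vertex set is a union of $199053$ stable sets. -/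

import Mathlib

namespace SimpleGraph

/-- The stable set polytope of `G`: the convex hull in `ℝ^V` of the incidence vectors of the
stable (independent) sets of `G`. -/
def stableSetPolytope {V : Type*} (G : SimpleGraph V) : Set (V → ℝ) :=
  convexHull ℝ {x | ∃ S : Set V, G.IsIndepSet S ∧ x = S.indicator 1}

open scoped Classical in
/-- The polytope cut out by the vertex bounds, the edge inequalities and the odd cycle
inequalities. The bound `x v ≤ 1` follows from an edge inequality and nonnegativity unless `v` is
isolated; it is listed so that the polyhedron is bounded, and hence the notion of t-perfection is
the usual one, closed under induced subgraphs, also for graphs with isolated vertices. -/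
def tStab {V : Type*} (G : SimpleGraph V) : Set (V → ℝ) :=
  {x | (∀ v, 0 ≤ x v ∧ x v ≤ 1) ∧
    (∀ u v, G.Adj u v → x u + x v ≤ 1) ∧
    (∀ (u : V) (c : G.Walk u u), c.IsCycle → Odd c.length →
      ∑ v ∈ c.support.toFinset, x v ≤ ((c.length : ℝ) - 1) / 2)}

/-- A graph is t-perfect if its stable set polytope is given by the vertex bounds, edge
inequalities and odd cycle inequalities. -/
def IsTPerfect {V : Type*} (G : SimpleGraph V) : Prop :=
  G.stableSetPolytope = G.tStab

end SimpleGraph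

/-!
A point of the stable set polytope is a convex combination of stable sets, and all of these are
tight at every valid inequality that is tight at the point. Applied to the constant point
`k / (2 k + 1)`, this gives a stable set meeting all odd closed walks of length `2 k + 1`. Deleting
`100` stable sets therefore raises the odd girth to `203` and makes all balls of radius `100`
bipartite.

Suppose that the remaining graph has large chromatic number. Some set of vertices at the same
distance from a vertex `z` induces a connected graph `K` of large chromatic number. Inside `K` one
builds a rope: a sequence of joints, far apart from each other, in which consecutive joints are
linked by induced paths of both parities. Closing up the rope and choosing the parities, one gets
for any three of five joints an induced odd cycle on which they cut off odd arcs. Geodesics from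
the joints towards `z` end in a connected set below `K`, which is bipartite when it is chosen
minimal. Three of the five joints then attach to the same side of it and turn it into a hub of the
cycle: a connected bipartite graph with sides `A` and `B` of which only `B` has neighbours on the
cycle, three of them cutting off odd arcs. A suitable point of `tStab` is tight at the cycle and at
all edges of the hub. A stable set tight at these and meeting `B` contains `B`, so it misses
those three vertices of the cycle and cannot be tight there.
-/

namespace TPerfect

open SimpleGraph

variable {V : Type*} {G : SimpleGraph V}

theorem exists_tight_isIndepSet {x : V → ℝ} (hx : x ∈ G.stableSetPolytope) {v : V}
    (hv : 0 < x v) :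
    ∃ S : Set V, G.IsIndepSet S ∧ v ∈ S ∧ ∀ f : (V → ℝ) →ₗ[ℝ] ℝ,
      (∀ T : Set V, G.IsIndepSet T → f (T.indicator 1) ≤ f x) → f (S.indicator 1) = f x := by
  rw [stableSetPolytope, mem_convexHull_iff_exists_fintype] at hx
  obtain ⟨ι, _, w, z, hw0, hw1, hz, rfl⟩ := hx
  choose S hS hzS using hz
  obtain rfl : z = fun i => (S i).indicator 1 := funext hzS
  obtain ⟨i, -, hi⟩ : ∃ i ∈ Finset.univ, 0 < w i * (S i).indicator 1 v :=
    Finset.exists_lt_of_sum_lt (f := fun _ => (0 : ℝ)) (by simpa using hv)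
  have hvi : v ∈ S i := by
    by_contra h
    simp [h] at hi
  have hwi : w i ≠ 0 := left_ne_zero_of_mul hi.ne'
  refine ⟨S i, hS i, hvi, fun f hf => ?_⟩
  set b := f (∑ i, w i • (S i).indicator 1) with hb
  have hsum : ∑ j, w j * (b - f ((S j).indicator 1)) = 0 := by
    simp only [mul_sub, Finset.sum_sub_distrib, ← Finset.sum_mul, hw1, one_mul]
    simp [hb]
  have hnonneg : ∀ j ∈ Finset.univ, 0 ≤ w j * (b - f ((S j).indicator 1)) := fun j _ =>
    mul_nonneg (hw0 j) (sub_nonneg.2 (hf _ (hS j)))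
  have hzero := (Finset.sum_eq_zero_iff_of_nonneg hnonneg).1 hsum i (Finset.mem_univ i)
  linarith [(mul_eq_zero.1 hzero).resolve_left hwi]

theorem indicator_add_indicator_le_one {S : Set V} (hS : G.IsIndepSet S) {u v : V}
    (h : G.Adj u v) : S.indicator (1 : V → ℝ) u + S.indicator (1 : V → ℝ) v ≤ 1 := by
  by_cases hu : u ∈ S <;> by_cases hv : v ∈ S
  · exact absurd h (hS hu hv h.ne)
  all_goals simp [hu, hv]

theorem sum_range_succ_of_closed {M : Type*} [AddCommMonoid M] {y : ℕ → M} {n : ℕ}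
    (h : y n = y 0) : ∑ i ∈ Finset.range n, y (i + 1) = ∑ i ∈ Finset.range n, y i := by
  cases n with
  | zero => simp
  | succ n => rw [Finset.sum_range_succ, h, Finset.sum_range_succ' y]

theorem two_mul_sum_range_le_of_closed {R : Type*} [CommRing R] [PartialOrder R] [IsOrderedRing R]
    {y : ℕ → R} {n : ℕ} (hy : y n = y 0) (h : ∀ i < n, y i + y (i + 1) ≤ 1) :
    2 * ∑ i ∈ Finset.range n, y i ≤ n :=
  calc 2 * ∑ i ∈ Finset.range n, y i = ∑ i ∈ Finset.range n, (y i + y (i + 1)) := by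
        rw [Finset.sum_add_distrib, sum_range_succ_of_closed hy, two_mul]
    _ ≤ ∑ _i ∈ Finset.range n, 1 := Finset.sum_le_sum fun i hi => h i (Finset.mem_range.1 hi)
    _ = n := by simp

theorem sum_indicator_le_of_odd_closed {S : Set V} (hS : G.IsIndepSet S) {n : ℕ} {v : ℕ → V}
    (hn : Odd n) (hv : v n = v 0) (hadj : ∀ i < n, G.Adj (v i) (v (i + 1))) :
    ∑ i ∈ Finset.range n, S.indicator (1 : V → ℝ) (v i) ≤ ((n : ℝ) - 1) / 2 := by
  classical
  have hle := two_mul_sum_range_le_of_closed (y := fun i => S.indicator (1 : V → ℝ) (v i))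
    (by simp only [hv]) fun i hi => indicator_add_indicator_le_one hS (hadj i hi)
  have hcard : ∑ i ∈ Finset.range n, S.indicator (1 : V → ℝ) (v i) =
      ((Finset.range n).filter (v · ∈ S)).card := by
    simp [Set.indicator_apply]
  rw [hcard] at hle ⊢
  obtain ⟨k, rfl⟩ := hn
  have hle' : 2 * ((Finset.range (2 * k + 1)).filter (v · ∈ S)).card ≤ 2 * k + 1 := by
    exact_mod_cast hle
  have hle'' : ((Finset.range (2 * k + 1)).filter (v · ∈ S)).card ≤ k := by omega
  push_cast
  linarith [(Nat.cast_le (α := ℝ)).2 hle'']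

theorem sum_Ico_le_half {y : ℕ → ℝ} {a b : ℕ} (hab : a ≤ b) (he : Even (b - a))
    (h : ∀ i, a ≤ i → i + 1 < b → y i + y (i + 1) ≤ 1) :
    ∑ i ∈ Finset.Ico a b, y i ≤ ((b : ℝ) - a) / 2 := by
  obtain ⟨t, ht⟩ := he
  obtain rfl : b = a + 2 * t := by omega
  clear ht hab
  induction t with
  | zero => simp
  | succ t ih =>
    have hlast := h (a + 2 * t) (by omega) (by omega)
    have hinit := ih fun i hai hi => h i hai (by omega)
    rw [show a + 2 * (t + 1) = a + 2 * t + 1 + 1 by ring, Finset.sum_Ico_succ_top (by omega),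
      Finset.sum_Ico_succ_top (by omega)]
    push_cast at hinit ⊢
    linarith

theorem sum_Ico_le_of_three_nonpos {y : ℕ → ℝ} {a p q r b : ℕ} (hap : a ≤ p) (hpq : p < q)
    (hqr : q < r) (hrb : r < b) (hap' : Even (p - a)) (hpq' : Odd (q - p)) (hqr' : Odd (r - q))
    (hrb' : Odd (b - r)) (h : ∀ i, i + 1 < b → y i + y (i + 1) ≤ 1)
    (hp : y p ≤ 0) (hq : y q ≤ 0) (hr : y r ≤ 0) :
    ∑ i ∈ Finset.Ico a b, y i ≤ ((b : ℝ) - a - 3) / 2 := by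
  rw [← Finset.sum_Ico_consecutive _ hap (by omega : p ≤ b),
    ← Finset.sum_Ico_consecutive _ hpq.le (by omega : q ≤ b),
    ← Finset.sum_Ico_consecutive _ hqr.le hrb.le, Finset.sum_eq_sum_Ico_succ_bot hpq,
    Finset.sum_eq_sum_Ico_succ_bot hqr, Finset.sum_eq_sum_Ico_succ_bot hrb]
  have h₀ := sum_Ico_le_half hap hap' fun i _ hi => h i (by omega)
  have h₁ := sum_Ico_le_half (y := y) hpq (by grind) fun i _ hi => h i (by omega)
  have h₂ := sum_Ico_le_half (y := y) hqr (by grind) fun i _ hi => h i (by omega)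
  have h₃ := sum_Ico_le_half (y := y) hrb (by grind) fun i _ hi => h i (by omega)
  push_cast at h₀ h₁ h₂ h₃
  linarith

theorem sum_range_le_of_three_nonpos {y : ℕ → ℝ} {n p q r : ℕ} (hn : Odd n) (hpq : p < q)
    (hqr : q < r) (hr : r < n) (hpq' : Odd (q - p)) (hqr' : Odd (r - q)) (hy : y n = y 0)
    (h : ∀ i < n, y i + y (i + 1) ≤ 1) (hp0 : y p ≤ 0) (hq0 : y q ≤ 0) (hr0 : y r ≤ 0) :
    ∑ i ∈ Finset.range n, y i ≤ ((n : ℝ) - 3) / 2 := by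
  rcases Nat.even_or_odd p with hp | hp
  · rw [Finset.range_eq_Ico]
    simpa using sum_Ico_le_of_three_nonpos p.zero_le hpq hqr hr (by simpa using hp) hpq' hqr'
      (by grind) (fun i hi => h i (by omega)) hp0 hq0 hr0
  · have hshift : ∑ i ∈ Finset.range n, y i = ∑ i ∈ Finset.Ico 1 (n + 1), y i := by
      rw [← sum_range_succ_of_closed hy, Finset.sum_Ico_eq_sum_range]
      simp only [Nat.add_sub_cancel, add_comm]
    rw [hshift]
    simpa using sum_Ico_le_of_three_nonpos hp.pos hpq hqr (by omega : r < n + 1) (by grind) hpq'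
      hqr' (by grind) (fun i hi => h i (by omega)) hp0 hq0 hr0

theorem sum_support_toFinset [DecidableEq V] {u : V} {c : G.Walk u u} (hc : c.IsCycle)
    (x : V → ℝ) :
    ∑ v ∈ c.support.toFinset, x v = ∑ i ∈ Finset.range c.length, x (c.getVert i) := by
  have hsupport : c.support.toFinset = (Finset.range c.length).image c.getVert := by
    ext v
    simp only [List.mem_toFinset, Finset.mem_image, Finset.mem_range,
      Walk.mem_support_iff_exists_getVert]
    constructor
    · rintro ⟨n, rfl, hn⟩
      rcases hn.lt_or_eq with h | rfl
      · exact ⟨n, h, rfl⟩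
      · exact ⟨0, by have := hc.three_le_length; omega, by simp⟩
    · rintro ⟨n, hn, rfl⟩
      exact ⟨n, rfl, hn.le⟩
  rw [hsupport, Finset.sum_image]
  intro i hi j hj hij
  rw [Finset.coe_range, Set.mem_Iio] at hi hj
  exact hc.getVert_injOn' (by simp; omega) (by simp; omega) hij

theorem sum_support_le_of_nonpos [DecidableEq V] {x : V → ℝ}
    (hadj : ∀ u v, G.Adj u v → x u + x v ≤ 1) {u : V} {c : G.Walk u u} (hc : c.IsCycle)
    (hodd : Odd c.length) {v : V} (hv : v ∈ c.support) (hxv : x v ≤ 0) :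
    ∑ v ∈ c.support.toFinset, x v ≤ ((c.length : ℝ) - 1) / 2 := by
  have hsupport : c.support.toFinset = (c.rotate v hv).support.toFinset := by
    ext w
    simp
  obtain ⟨k, hk⟩ := hodd
  have hlen : (c.rotate v hv).length = 2 * k + 1 := by rw [Walk.length_rotate, hk]
  rw [hsupport, sum_support_toFinset (hc.rotate hv), hlen, hk, Finset.range_eq_Ico,
    Finset.sum_eq_sum_Ico_succ_bot (by omega), Walk.getVert_zero]
  have := sum_Ico_le_half (y := fun i => x ((c.rotate v hv).getVert i))
    (by omega : 0 + 1 ≤ 2 * k + 1) (by simp)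
    fun i _ hi => hadj _ _ (Walk.adj_getVert_succ _ (by omega))
  push_cast at this ⊢
  linarith

theorem mem_tStab_of_support {x : V → ℝ} (h01 : ∀ v, 0 ≤ x v ∧ x v ≤ 1)
    (hadj : ∀ u v, G.Adj u v → x u + x v ≤ 1)
    (hcycle : ∀ (u : V) (c : G.Walk u u), c.IsCycle → Odd c.length →
      (∀ v ∈ c.support, x v ≠ 0) →
      ∑ i ∈ Finset.range c.length, x (c.getVert i) ≤ ((c.length : ℝ) - 1) / 2) :
    x ∈ G.tStab := by
  classical
  refine ⟨h01, hadj, fun u c hc hodd => ?_⟩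
  by_cases hs : ∀ v ∈ c.support, x v ≠ 0
  · convert hcycle u c hc hodd hs
    convert sum_support_toFinset hc x
  · push Not at hs
    obtain ⟨v, hv, hxv⟩ := hs
    convert sum_support_le_of_nonpos hadj hc hodd hv hxv.le

theorem comp_mem_stableSetPolytope {W : Type*} {H : SimpleGraph W} (φ : H →g G) {x : V → ℝ}
    (hx : x ∈ G.stableSetPolytope) : x ∘ φ ∈ H.stableSetPolytope := by
  have himage : LinearMap.funLeft ℝ ℝ φ x ∈ LinearMap.funLeft ℝ ℝ φ '' G.stableSetPolytope :=
    Set.mem_image_of_mem _ hx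
  rw [stableSetPolytope, LinearMap.image_convexHull] at himage
  refine convexHull_mono ?_ himage
  rintro _ ⟨_, ⟨S, hS, rfl⟩, rfl⟩
  exact ⟨φ ⁻¹' S, fun a ha b hb _ hab => hS ha hb (φ.map_adj hab).ne (φ.map_adj hab), rfl⟩

theorem length_induce {X : Set V} {u v : V} (c : G.Walk u v) (hX : ∀ w ∈ c.support, w ∈ X) :
    (c.induce X hX).length = c.length :=
  (Walk.length_map _ (c.induce X hX)).symm.trans (congrArg Walk.length (c.map_induce hX))

theorem getVert_induce {X : Set V} {u v : V} (c : G.Walk u v) (hX : ∀ w ∈ c.support, w ∈ X)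
    (i : ℕ) : ((c.induce X hX).getVert i : V) = c.getVert i :=
  (Walk.getVert_map _ (c.induce X hX) i).symm.trans
    (congrArg (fun d : G.Walk u v => d.getVert i) (c.map_induce hX))

theorem isCycle_induce {X : Set V} {u : V} {c : G.Walk u u} (hc : c.IsCycle)
    (hX : ∀ w ∈ c.support, w ∈ X) : (c.induce X hX).IsCycle := by
  rw [← Walk.isCycle_map_iff_of_injective (f := (Embedding.induce X).toHom)
    (Embedding.induce (G := G) X).injective]
  exact (c.map_induce hX).symm ▸ hc

theorem tStab_subset_induce (hG : G.tStab ⊆ G.stableSetPolytope) (X : Set V) :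
    (G.induce X).tStab ⊆ (G.induce X).stableSetPolytope := by
  classical
  rintro x ⟨h01, hadj, hcycle⟩
  let y : V → ℝ := Function.extend ((↑) : X → V) x 0
  have hyX (v : X) : y v = x v := Subtype.val_injective.extend_apply _ _ v
  have hy0 {v : V} (hv : v ∉ X) : y v = 0 := Function.extend_apply' _ _ _ (by simpa using hv)
  have hy01 (v : V) : 0 ≤ y v ∧ y v ≤ 1 := by
    by_cases hv : v ∈ X
    · exact hyX ⟨v, hv⟩ ▸ h01 _
    · simp [hy0 hv]
  have hy : y ∈ G.tStab := by
    refine mem_tStab_of_support hy01 (fun u v huv => ?_) fun u c hc hodd hs => ?_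
    · by_cases hu : u ∈ X
      · by_cases hv : v ∈ X
        · exact hyX ⟨u, hu⟩ ▸ hyX ⟨v, hv⟩ ▸ hadj _ _ huv
        · linarith [hy0 hv, (hy01 u).2]
      · linarith [hy0 hu, (hy01 v).2]
    · have hX : ∀ v ∈ c.support, v ∈ X := fun v hv => by_contra fun h => hs v hv (hy0 h)
      have hle := hcycle _ _ (isCycle_induce hc hX) (by rwa [length_induce])
      have hsum := sum_support_toFinset (isCycle_induce hc hX) x
      simp only [length_induce, ← hyX, getVert_induce] at hle hsum
      rw [← hsum]
      convert hle
  have hx : y ∘ (Embedding.induce (G := G) X).toHom = x := funext hyX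
  exact hx ▸ comp_mem_stableSetPolytope _ (hG hy)

/-- `OddGirthGE G n` says that the odd girth of `G` is at least `n`. It is stated for closed walks
rather than cycles, which is equivalent, since a shortest odd closed walk is a cycle. -/
def OddGirthGE (G : SimpleGraph V) (n : ℕ) : Prop :=
  ∀ (u : V) (c : G.Walk u u), Odd c.length → n ≤ c.length

theorem OddGirthGE.three (G : SimpleGraph V) : OddGirthGE G 3 := by
  intro u c hodd
  have hne : c.length ≠ 1 := fun h => (Walk.adj_of_length_eq_one h).ne rfl
  obtain ⟨k, hk⟩ := hodd
  omega

theorem OddGirthGE.induce {n : ℕ} (h : OddGirthGE G n) (X : Set V) :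
    OddGirthGE (G.induce X) n := by
  intro u c hc
  have hlen : (c.map (Embedding.induce (G := G) X).toHom).length = c.length := Walk.length_map _ c
  exact hlen ▸ h _ _ (hlen ▸ hc)

theorem const_mem_tStab {k : ℕ} (hk : 1 ≤ k) (hodd : OddGirthGE G (2 * k + 1)) :
    (fun _ => (k : ℝ) / (2 * k + 1)) ∈ G.tStab := by
  have hk' : (1 : ℝ) ≤ k := by exact_mod_cast hk
  have hpos : (0 : ℝ) < 2 * k + 1 := by linarith
  refine mem_tStab_of_support (fun _ => ⟨by positivity, ?_⟩) (fun u v _ => ?_)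
    fun u c _ hc _ => ?_
  · rw [div_le_one hpos]
    linarith
  · rw [← add_div, div_le_one hpos]
    linarith
  · have hlen : 2 * (k : ℝ) + 1 ≤ c.length := by exact_mod_cast hodd u c hc
    rw [Finset.sum_const, Finset.card_range, nsmul_eq_mul, mul_div_assoc',
      div_le_div_iff₀ hpos two_pos]
    nlinarith

/-- The constant vector with value `k / (2 k + 1)` is tight at all closed walks of length
`2 k + 1`, so a stable set in its support meets each of them. -/
theorem exists_isIndepSet_oddGirthGE_compl (hG : G.tStab ⊆ G.stableSetPolytope) {k : ℕ}
    (hk : 1 ≤ k) (hodd : OddGirthGE G (2 * k + 1)) :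
    ∃ S : Set V, G.IsIndepSet S ∧ OddGirthGE (G.induce Sᶜ) (2 * k + 3) := by
  cases isEmpty_or_nonempty V with
  | inl _ => exact ⟨∅, by simp [IsIndepSet], fun u => isEmptyElim u⟩
  | inr hV =>
    have hk0 : (0 : ℝ) < k := by exact_mod_cast hk
    obtain ⟨S, hS, -, htight⟩ := exists_tight_isIndepSet (hG (const_mem_tStab hk hodd))
      (v := hV.some) (by positivity)
    refine ⟨S, hS, fun u c hc => ?_⟩
    have hge := hodd.induce _ u c hc
    rcases hge.lt_or_eq with hlt | heq
    · obtain ⟨m, hm⟩ := hc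
      omega
    exfalso
    let d := c.map (Embedding.induce (G := G) Sᶜ).toHom
    have hd : d.length = 2 * k + 1 := (Walk.length_map _ c).trans heq.symm
    have hdS (i : ℕ) : d.getVert i ∉ S := by
      rw [Walk.getVert_map]
      exact (c.getVert i).2
    have hsum := htight (∑ i ∈ Finset.range (2 * k + 1), LinearMap.proj (d.getVert i))
      fun T hT => by
        have hle := sum_indicator_le_of_odd_closed hT (odd_two_mul_add_one k) (v := d.getVert)
          (by rw [← hd, d.getVert_length, d.getVert_zero]) fun i hi => d.adj_getVert_succ (hd ▸ hi)
        simp only [LinearMap.sum_apply, LinearMap.proj_apply, Finset.sum_const, Finset.card_range,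
          nsmul_eq_mul]
        push_cast at hle ⊢
        field_simp at hle ⊢
        linarith
    simp only [LinearMap.sum_apply, LinearMap.proj_apply, Set.indicator_of_notMem (hdS _),
      Finset.sum_const, Finset.card_range, nsmul_eq_mul] at hsum
    field_simp at hsum
    nlinarith

/-! ### Hubs of odd cycles -/

/-- The vertices `o 0, …, o (N - 1)` form an induced cycle of `G`, in this order. -/
structure IsInducedCycle (G : SimpleGraph V) (o : ℕ → V) (N : ℕ) : Prop where
  closed : o N = o 0
  injOn : Set.InjOn o (Set.Iio N)
  adj_iff : ∀ i j, i < j → j < N → (G.Adj (o i) (o j) ↔ j = i + 1 ∨ (i = 0 ∧ j + 1 = N))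

namespace IsInducedCycle

variable {o : ℕ → V} {N : ℕ}

theorem adj_succ (ho : IsInducedCycle G o N) (hN : 2 ≤ N) {i : ℕ} (hi : i < N) :
    G.Adj (o i) (o (i + 1)) := by
  rcases Nat.lt_or_ge (i + 1) N with h | h
  · exact (ho.adj_iff i (i + 1) (by omega) h).2 (Or.inl rfl)
  · obtain rfl : N = i + 1 := by omega
    rw [ho.closed]
    exact ((ho.adj_iff 0 i (by omega) hi).2 (Or.inr ⟨rfl, rfl⟩)).symm

theorem two_colorable_image_diff (ho : IsInducedCycle G o N) (hN : Odd N) {j : ℕ} (hj : j < N) :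
    (G.induce (o '' (Set.Iio N \ {j}))).Colorable 2 := by
  choose g hg hog using fun v : o '' (Set.Iio N \ {j}) => v.2
  have hgN (v) : g v < N := (hg v).1
  have hgj (v) : g v ≠ j := (hg v).2
  -- Deleting `o j` closes the gap in the parities of the positions.
  let κ (i : ℕ) : ℕ := if i < j then i else i + 1
  have hκ {a b : ℕ} (hab : a < b) (hb : b < N) (haj : a ≠ j) (hbj : b ≠ j)
      (hadj : G.Adj (o a) (o b)) : decide (Even (κ a)) ≠ decide (Even (κ b)) := by
    have := (ho.adj_iff a b hab hb).1 hadj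
    simp only [κ, ne_eq, decide_eq_decide]
    split_ifs <;> grind
  refine (Coloring.mk (fun v => decide (Even (κ (g v)))) fun {u v} huv => ?_ :
    (G.induce (o '' (Set.Iio N \ {j}))).Coloring Bool).colorable
  have hadj : G.Adj (o (g u)) (o (g v)) := by rwa [hog, hog]
  rcases lt_trichotomy (g u) (g v) with h | h | h
  · exact hκ h (hgN v) (hgj u) (hgj v) hadj
  · exact absurd (h ▸ rfl) hadj.ne
  · exact (hκ h (hgN u) (hgj v) (hgj u) hadj.symm).symm

theorem mem_support_of_odd (ho : IsInducedCycle G o N) (hN : Odd N) {u : V} {c : G.Walk u u}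
    (hc : Odd c.length) (hO : ∀ v ∈ c.support, v ∈ o '' Set.Iio N) {j : ℕ} (hj : j < N) :
    o j ∈ c.support := by
  by_contra hjc
  have hX : ∀ v ∈ c.support, v ∈ o '' (Set.Iio N \ {j}) := fun v hv => by
    obtain ⟨i, hi, rfl⟩ := hO v hv
    exact ⟨i, ⟨hi, fun hij : i = j => hjc (hij ▸ hv)⟩, rfl⟩
  have heven := two_colorable_iff_forall_loop_even.1 (ho.two_colorable_image_diff hN hj) _
    (c.induce _ hX)
  rw [length_induce] at heven
  exact Nat.not_even_iff_odd.2 hc heven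

theorem le_length_of_odd (ho : IsInducedCycle G o N) (hN : Odd N) {u : V} {c : G.Walk u u}
    (hc : Odd c.length) (hO : ∀ v ∈ c.support, v ∈ o '' Set.Iio N) : N ≤ c.length := by
  have hsub : (List.range N).map o ⊆ c.support.tail := by
    intro v hv
    obtain ⟨j, hj, rfl⟩ := List.mem_map.1 hv
    rcases c.mem_support_iff.1 (ho.mem_support_of_odd hN hc hO (List.mem_range.1 hj)) with h | h
    · rw [h]
      exact c.end_mem_tail_support fun hnil => by simp [Walk.length_eq_zero_iff.2 hnil] at hc
    · exact h
  have hnodup : ((List.range N).map o).Nodup :=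
    List.nodup_range.map_on fun i hi j hj => ho.injOn (List.mem_range.1 hi) (List.mem_range.1 hj)
  simpa using (hnodup.subperm hsub).length_le

end IsInducedCycle

theorem eq_zero_or_sum_lt_sum_of_closed {α β : ℕ → ℤ} {n : ℕ} (hn : Odd n) (hα0 : ∀ i, 0 ≤ α i)
    (hβ0 : ∀ i, 0 ≤ β i) (hle : ∀ i, α i + β i ≤ 1) (hα : α n = α 0) (hβ : β n = β 0)
    (hαβ : ∀ i < n, α i ≤ β (i + 1)) (hβα : ∀ i < n, α (i + 1) ≤ β i) :
    (∀ i ≤ n, α i = 0 ∧ β i = 0) ∨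
      ∑ i ∈ Finset.range n, α i < ∑ i ∈ Finset.range n, β i := by
  have hsumα := sum_range_succ_of_closed hα
  have hsumβ := sum_range_succ_of_closed hβ
  rw [or_iff_not_imp_right, not_lt]
  intro hba
  have hab : ∑ i ∈ Finset.range n, α i ≤ ∑ i ∈ Finset.range n, β i :=
    hsumβ ▸ Finset.sum_le_sum fun i hi => hαβ i (Finset.mem_range.1 hi)
  have hsum := hab.antisymm hba
  have hα_eq : ∀ i ∈ Finset.range n, α i = β (i + 1) :=
    (Finset.sum_eq_sum_iff_of_le fun i hi => hαβ i (Finset.mem_range.1 hi)).1 (by rw [hsumβ, hsum])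
  have hβ_eq : ∀ i ∈ Finset.range n, α (i + 1) = β i :=
    (Finset.sum_eq_sum_iff_of_le fun i hi => hβα i (Finset.mem_range.1 hi)).1 (by rw [hsumα, hsum])
  have hconst : ∀ i ≤ n, α i + β i = α 0 + β 0 := by
    intro i
    induction i with
    | zero => simp
    | succ i ih =>
      intro hi
      rw [← ih (by omega), hα_eq i (Finset.mem_range.2 hi), hβ_eq i (Finset.mem_range.2 hi),
        add_comm]
  have hzero : α 0 + β 0 = 0 := by
    by_contra h0
    have h1 : α 0 + β 0 = 1 := by linarith [hle 0, (add_nonneg (hα0 0) (hβ0 0)).lt_of_ne' h0]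
    have htotal : ∑ i ∈ Finset.range n, (α i + β i) = n := by
      rw [Finset.sum_congr rfl fun i hi => (hconst i (Finset.mem_range.1 hi).le).trans h1]
      simp
    rw [Finset.sum_add_distrib, hsum] at htotal
    obtain ⟨k, hk⟩ := hn
    omega
  intro i hi
  constructor <;> linarith [hconst i hi, hα0 i, hβ0 i]

/-- A hub of the cycle `o 0, …, o (N - 1)`: a connected bipartite graph with sides `A` and `B`,
disjoint from the cycle, such that only `B` has neighbours on the cycle. -/
structure IsHub (G : SimpleGraph V) (o : ℕ → V) (N : ℕ) (A B : Set V) : Prop where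
  isIndepSet_left : G.IsIndepSet A
  isIndepSet_right : G.IsIndepSet B
  disjoint : Disjoint A B
  preconnected : (G.induce (A ∪ B)).Preconnected
  notMem_left : ∀ i < N, o i ∉ A
  notMem_right : ∀ i < N, o i ∉ B
  not_adj : ∀ i < N, ∀ a ∈ A, ¬ G.Adj a (o i)

open scoped Classical in
/-- A point of the polytope `tStab` which is tight at the cycle `o 0, …, o (N - 1)` and at all
edges between the two sides `A` and `B` of a hub of this cycle. -/
noncomputable def hubPoint (o : ℕ → V) (N : ℕ) (A B : Set V) (v : V) : ℝ :=
  if v ∈ A then 1 - 1 / N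
  else if v ∈ B then 1 / N
  else if v ∈ o '' Set.Iio N then 1 / 2 - 1 / (2 * N)
  else 0

namespace IsHub

variable {o : ℕ → V} {N : ℕ} {A B : Set V}

theorem hubPoint_left {v : V} (hv : v ∈ A) : hubPoint o N A B v = 1 - 1 / N := if_pos hv

theorem hubPoint_right (h : IsHub G o N A B) {v : V} (hv : v ∈ B) :
    hubPoint o N A B v = 1 / N := by
  rw [hubPoint, if_neg (h.disjoint.notMem_of_mem_right hv), if_pos hv]

theorem hubPoint_cycle (h : IsHub G o N A B) {i : ℕ} (hi : i < N) :
    hubPoint o N A B (o i) = 1 / 2 - 1 / (2 * N) := by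
  rw [hubPoint, if_neg (h.notMem_left i hi), if_neg (h.notMem_right i hi), if_pos ⟨i, hi, rfl⟩]

theorem mem_of_hubPoint_ne_zero {v : V} (hv : hubPoint o N A B v ≠ 0) :
    v ∈ A ∨ v ∈ B ∨ v ∈ o '' Set.Iio N := by
  contrapose! hv
  rw [hubPoint, if_neg hv.1, if_neg hv.2.1, if_neg hv.2.2]

theorem hubPoint_mem_Icc (hN : 1 ≤ N) (v : V) :
    0 ≤ hubPoint o N A B v ∧ hubPoint o N A B v ≤ 1 := by
  have hN' : (1 : ℝ) ≤ N := by exact_mod_cast hN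
  have hpos : (0 : ℝ) < 1 / N := by positivity
  have hle : (1 : ℝ) / N ≤ 1 := (div_le_one (by positivity)).2 hN'
  have hhalf : (1 : ℝ) / (2 * N) = 1 / N / 2 := by field_simp
  unfold hubPoint
  split_ifs <;> constructor <;> linarith

theorem mem_right_of_adj (h : IsHub G o N A B) {u v : V} (hu : u ∈ A) (huv : G.Adj u v)
    (hv : v ∈ A ∨ v ∈ B ∨ v ∈ o '' Set.Iio N) : v ∈ B := by
  rcases hv with hv | hv | ⟨i, hi, rfl⟩
  · exact absurd huv (h.isIndepSet_left hu hv huv.ne)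
  · exact hv
  · exact absurd huv (h.not_adj i hi u hu)

theorem hubPoint_add_le (h : IsHub G o N A B) (hN : 2 ≤ N) {u v : V} (huv : G.Adj u v) :
    hubPoint o N A B u + hubPoint o N A B v ≤ 1 := by
  have hbound := hubPoint_mem_Icc (o := o) (A := A) (B := B) (by omega : 1 ≤ N)
  by_cases hu0 : hubPoint o N A B u = 0
  · linarith [hbound v]
  by_cases hv0 : hubPoint o N A B v = 0
  · linarith [hbound u]
  have hu := mem_of_hubPoint_ne_zero hu0
  have hv := mem_of_hubPoint_ne_zero hv0
  have hle : (1 : ℝ) / N ≤ 1 / 2 := one_div_le_one_div_of_le two_pos (by exact_mod_cast hN)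
  have hpos : (0 : ℝ) ≤ 1 / (2 * N) := by positivity
  have hhalf {w : V} (hwA : w ∉ A) : hubPoint o N A B w ≤ 1 / 2 := by
    rw [hubPoint, if_neg hwA]
    split_ifs <;> linarith
  by_cases huA : u ∈ A
  · rw [hubPoint_left huA, h.hubPoint_right (h.mem_right_of_adj huA huv hv)]
    linarith
  by_cases hvA : v ∈ A
  · rw [hubPoint_left hvA, h.hubPoint_right (h.mem_right_of_adj hvA huv.symm hu)]
    linarith
  linarith [hhalf huA, hhalf hvA]

theorem hubPoint_eq (h : IsHub G o N A B) {v : V} (hv : v ∈ A ∨ v ∈ B ∨ v ∈ o '' Set.Iio N) :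
    hubPoint o N A B v = 1 / 2 - 1 / (2 * N)
      + (1 / 2 - 1 / (2 * N)) * (A.indicator 1 v : ℤ)
      + (3 / (2 * N) - 1 / 2) * (B.indicator 1 v : ℤ) := by
  have hN : (3 : ℝ) / (2 * N) = 1 / N + 1 / (2 * N) := by field_simp; norm_num
  have hN' : (1 : ℝ) / N = 2 * (1 / (2 * N)) := by field_simp
  rcases hv with hA | hB | ⟨i, hi, rfl⟩
  · simp only [hubPoint_left hA, Set.indicator_of_mem hA,
      Set.indicator_of_notMem (h.disjoint.notMem_of_mem_left hA), Pi.one_apply]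
    push_cast
    linarith
  · simp only [h.hubPoint_right hB, Set.indicator_of_mem hB,
      Set.indicator_of_notMem (h.disjoint.notMem_of_mem_right hB), Pi.one_apply]
    push_cast
    linarith
  · simp [h.hubPoint_cycle hi, h.notMem_left i hi, h.notMem_right i hi]

theorem notMem_or_sum_lt_sum (h : IsHub G o N A B) {u : V} {c : G.Walk u u} (hc : Odd c.length)
    (hs : ∀ v ∈ c.support, v ∈ A ∨ v ∈ B ∨ v ∈ o '' Set.Iio N) :
    (∀ i ≤ c.length, c.getVert i ∉ A ∧ c.getVert i ∉ B) ∨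
      ∑ i ∈ Finset.range c.length, (A.indicator 1 (c.getVert i) : ℤ) <
        ∑ i ∈ Finset.range c.length, (B.indicator 1 (c.getVert i) : ℤ) := by
  have hclosed : c.getVert c.length = c.getVert 0 := by rw [c.getVert_length, c.getVert_zero]
  have hadj {u v : V} (huv : G.Adj u v) (hv : v ∈ c.support) :
      (A.indicator 1 u : ℤ) ≤ B.indicator 1 v := by
    by_cases hu : u ∈ A
    · simp [hu, h.mem_right_of_adj hu huv (hs v hv)]
    · rw [Set.indicator_of_notMem hu]
      exact Set.indicator_nonneg (fun _ _ => zero_le_one) _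
  refine (eq_zero_or_sum_lt_sum_of_closed hc (α := fun i => A.indicator 1 (c.getVert i))
    (β := fun i => B.indicator 1 (c.getVert i)) (fun i => ?_) (fun i => ?_) (fun i => ?_)
    (congrArg _ hclosed) (congrArg _ hclosed)
    (fun i hi => hadj (c.adj_getVert_succ hi) (c.getVert_mem_support _))
    (fun i hi => hadj (c.adj_getVert_succ hi).symm (c.getVert_mem_support _))).imp_left ?_
  · exact Set.indicator_nonneg (fun _ _ => zero_le_one) _
  · exact Set.indicator_nonneg (fun _ _ => zero_le_one) _
  · by_cases hA : c.getVert i ∈ A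
    · simp [hA, h.disjoint.notMem_of_mem_left hA]
    · by_cases hB : c.getVert i ∈ B <;> simp [hA, hB]
  · intro hzero i hi
    simpa [Set.indicator_apply] using hzero i hi

theorem sum_hubPoint_le (h : IsHub G o N A B) (ho : IsInducedCycle G o N) (hN : Odd N) {u : V}
    {c : G.Walk u u} (hc : Odd c.length)
    (hs : ∀ v ∈ c.support, v ∈ A ∨ v ∈ B ∨ v ∈ o '' Set.Iio N) :
    ∑ i ∈ Finset.range c.length, hubPoint o N A B (c.getVert i) ≤ ((c.length : ℝ) - 1) / 2 := by
  have hpos : (0 : ℝ) < N := by exact_mod_cast hN.pos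
  rcases h.notMem_or_sum_lt_sum hc hs with hO | hlt
  · have hcycle : ∀ v ∈ c.support, v ∈ o '' Set.Iio N := by
      intro v hv
      obtain ⟨i, rfl, hi⟩ := Walk.mem_support_iff_exists_getVert.1 hv
      exact ((hs _ hv).resolve_left (hO i hi).1).resolve_left (hO i hi).2
    have hle : (N : ℝ) ≤ c.length := by exact_mod_cast ho.le_length_of_odd hN hc hcycle
    have hvalue : ∀ i ∈ Finset.range c.length,
        hubPoint o N A B (c.getVert i) = 1 / 2 - 1 / (2 * N) := by
      intro i _
      obtain ⟨j, hj, hij⟩ := hcycle _ (c.getVert_mem_support i)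
      rw [← hij, h.hubPoint_cycle hj]
    rw [Finset.sum_congr rfl hvalue, Finset.sum_const, Finset.card_range, nsmul_eq_mul]
    field_simp
    linarith
  · have hb := two_mul_sum_range_le_of_closed (n := c.length)
      (y := fun i => (B.indicator 1 (c.getVert i) : ℤ))
      (by simp only [c.getVert_length, c.getVert_zero]) fun i hi => by
        have hadj := c.adj_getVert_succ hi
        by_cases hi : c.getVert i ∈ B <;> by_cases hi' : c.getVert (i + 1) ∈ B
        · exact absurd hadj (h.isIndepSet_right hi hi' hadj.ne)
        all_goals simp [hi, hi']
    rw [Finset.sum_congr rfl fun i _ => h.hubPoint_eq (hs _ (c.getVert_mem_support i))]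
    simp only [Finset.sum_add_distrib, ← Finset.mul_sum, Finset.sum_const, Finset.card_range,
      nsmul_eq_mul, ← Int.cast_sum]
    set a := ∑ i ∈ Finset.range c.length, (A.indicator 1 (c.getVert i) : ℤ)
    set b := ∑ i ∈ Finset.range c.length, (B.indicator 1 (c.getVert i) : ℤ)
    have hab : (a : ℝ) + 1 ≤ b := by exact_mod_cast hlt
    have hb' : 2 * (b : ℝ) + 1 ≤ c.length := by
      obtain ⟨k, hk⟩ := hc
      exact_mod_cast (by omega : 2 * b + 1 ≤ c.length)
    have hN1 : (1 : ℝ) ≤ N := by exact_mod_cast hN.pos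
    field_simp
    nlinarith

theorem hubPoint_mem_tStab (h : IsHub G o N A B) (ho : IsInducedCycle G o N) (hN : Odd N)
    (hN2 : 2 ≤ N) : hubPoint o N A B ∈ G.tStab :=
  mem_tStab_of_support (hubPoint_mem_Icc (by omega)) (fun _ _ => h.hubPoint_add_le hN2)
    fun _ _ _ hc hs => h.sum_hubPoint_le ho hN hc fun v hv => mem_of_hubPoint_ne_zero (hs v hv)

theorem mem_of_walk (h : IsHub G o N A B) {S : Set V}
    (hS : ∀ a ∈ A, ∀ b ∈ B, G.Adj a b → (a ∈ S ↔ b ∉ S)) {u v : ↑(A ∪ B)}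
    (w : (G.induce (A ∪ B)).Walk u v) (hu : (u : V) ∈ S ↔ (u : V) ∈ B) :
    (v : V) ∈ S ↔ (v : V) ∈ B := by
  induction w with
  | nil => exact hu
  | @cons u v _ huv _ ih =>
    apply ih
    have huv' : G.Adj (u : V) v := huv
    have hA {w : V} (hw : w ∈ A) : w ∉ B := h.disjoint.notMem_of_mem_left hw
    rcases u.2 with huA | huB <;> rcases v.2 with hvA | hvB
    · exact absurd huv' (h.isIndepSet_left huA hvA huv'.ne)
    · have := hS _ huA _ hvB huv'
      have := hA huA
      tauto
    · have := hS _ hvA _ huB huv'.symm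
      have := hA hvA
      tauto
    · exact absurd huv' (h.isIndepSet_right huB hvB huv'.ne)

theorem subset_of_tight (h : IsHub G o N A B) {S : Set V} {b : V}
    (hb : b ∈ B) (hbS : b ∈ S)
    (htight : ∀ f : (V → ℝ) →ₗ[ℝ] ℝ, (∀ T : Set V, G.IsIndepSet T →
      f (T.indicator 1) ≤ f (hubPoint o N A B)) → f (S.indicator 1) = f (hubPoint o N A B)) :
    B ⊆ S := by
  have hedge : ∀ a ∈ A, ∀ b ∈ B, G.Adj a b → (a ∈ S ↔ b ∉ S) := by
    intro a ha b hb hab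
    have hone : hubPoint o N A B a + hubPoint o N A B b = 1 := by
      rw [hubPoint_left ha, h.hubPoint_right hb]
      ring
    have hsum := htight (.proj a + .proj b) fun T hT => by
      rw [LinearMap.add_apply, LinearMap.add_apply]
      exact (indicator_add_indicator_le_one hT hab).trans_eq hone.symm
    rw [LinearMap.add_apply, LinearMap.add_apply] at hsum
    replace hsum := hsum.trans hone
    by_cases haS : a ∈ S <;> by_cases hbS : b ∈ S <;> simp_all
  intro v hv
  obtain ⟨w⟩ := h.preconnected ⟨b, Or.inr hb⟩ ⟨v, Or.inr hv⟩
  exact (h.mem_of_walk hedge w (iff_of_true hbS hb)).2 hv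

end IsHub

/-- A stable set which is tight where the hub point is and meets `B` contains `B`, so it misses
three vertices of the cycle, which is too many for it to be tight at the cycle. -/
theorem false_of_isHub (hG : G.tStab ⊆ G.stableSetPolytope) {o : ℕ → V} {N p q r : ℕ}
    {A B : Set V} (h : IsHub G o N A B) (ho : IsInducedCycle G o N) (hN : Odd N) (hpq : p < q)
    (hqr : q < r) (hr : r < N) (hpq' : Odd (q - p)) (hqr' : Odd (r - q))
    (hp : ∃ b ∈ B, G.Adj b (o p)) (hq : ∃ b ∈ B, G.Adj b (o q))
    (hr' : ∃ b ∈ B, G.Adj b (o r)) : False := by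
  have hN2 : 2 ≤ N := by omega
  have hpos : (0 : ℝ) < N := by exact_mod_cast hN.pos
  obtain ⟨b, hb, hbp⟩ := hp
  obtain ⟨S, hS, hbS, htight⟩ := exists_tight_isIndepSet (hG (h.hubPoint_mem_tStab ho hN hN2))
    (v := b) (by rw [h.hubPoint_right hb]; exact one_div_pos.2 hpos)
  have hBS : B ⊆ S := h.subset_of_tight hb hbS htight
  have hcycle : ∑ i ∈ Finset.range N, hubPoint o N A B (o i) = ((N : ℝ) - 1) / 2 := by
    rw [Finset.sum_congr rfl fun i hi => h.hubPoint_cycle (Finset.mem_range.1 hi),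
      Finset.sum_const, Finset.card_range, nsmul_eq_mul]
    field_simp
  have hsum := htight (∑ i ∈ Finset.range N, LinearMap.proj (o i)) fun T hT => by
    simpa [hcycle] using sum_indicator_le_of_odd_closed hT hN ho.closed fun i => ho.adj_succ hN2
  simp only [LinearMap.sum_apply, LinearMap.proj_apply, hcycle] at hsum
  have hzero {j : ℕ} (hj : ∃ b ∈ B, G.Adj b (o j)) : S.indicator (1 : V → ℝ) (o j) ≤ 0 := by
    obtain ⟨b, hb, hbj⟩ := hj
    exact (Set.indicator_of_notMem (fun hjS => hS (hBS hb) hjS hbj.ne hbj) _).le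
  have hle := sum_range_le_of_three_nonpos (y := fun i => S.indicator (1 : V → ℝ) (o i)) hN hpq hqr
    hr hpq' hqr' (by simp only [ho.closed])
    (fun i hi => indicator_add_indicator_le_one hS (ho.adj_succ hN2 hi))
    (hzero ⟨b, hb, hbp⟩) (hzero hq) (hzero hr')
  linarith

theorem colorable_induce_of_ne {α : Type*} [Fintype α] {X : Set V} (κ : V → α)
    (hκ : ∀ x ∈ X, ∀ y ∈ X, G.Adj x y → κ x ≠ κ y) :
    (G.induce X).Colorable (Fintype.card α) :=
  (Coloring.mk (fun x : X => κ x) fun {x y} hxy => hκ x x.2 y y.2 hxy).colorable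

theorem exists_ne_of_colorable_induce_two {X : Set V} (hX : (G.induce X).Colorable 2) :
    ∃ κ : V → Bool, ∀ x ∈ X, ∀ y ∈ X, G.Adj x y → κ x ≠ κ y := by
  classical
  let C := hX.toColoring (α := Bool) (by simp)
  refine ⟨fun x => if hx : x ∈ X then C ⟨x, hx⟩ else false, fun x hx y hy hxy => ?_⟩
  simp only [dif_pos hx, dif_pos hy]
  exact C.valid (v := ⟨x, hx⟩) (w := ⟨y, hy⟩) hxy

theorem colorable_induce_mono {n m : ℕ} {X Y : Set V} (hY : (G.induce Y).Colorable n) (hX : X ⊆ Y)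
    (hn : n ≤ m) : (G.induce X).Colorable m :=
  (hY.of_hom (G.induceHomOfLE hX).toHom).mono hn

theorem colorable_induce_union {n m : ℕ} {X Y : Set V} (hX : (G.induce X).Colorable n)
    (hY : (G.induce Y).Colorable m) : (G.induce (X ∪ Y)).Colorable (n + m) := by
  classical
  obtain ⟨C⟩ := hX
  obtain ⟨D⟩ := hY
  let κ : ↥(X ∪ Y) → Fin n ⊕ Fin m := fun v =>
    if h : v.1 ∈ X then .inl (C ⟨v, h⟩) else .inr (D ⟨v, v.2.resolve_left h⟩)
  have hκ : ∀ {v w}, (G.induce (X ∪ Y)).Adj v w → κ v ≠ κ w := by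
    intro v w hvw
    simp only [κ]
    split_ifs with hv hw hw
    · exact fun h => C.valid (v := ⟨v, hv⟩) (w := ⟨w, hw⟩) hvw (Sum.inl_injective h)
    · exact Sum.inl_ne_inr
    · exact Sum.inr_ne_inl
    · exact fun h => D.valid (v := ⟨v, _⟩) (w := ⟨w, _⟩) hvw (Sum.inr_injective h)
  simpa using (Coloring.mk κ hκ).colorable

theorem not_colorable_induce_diff {n m : ℕ} {X Y : Set V} (hX : ¬ (G.induce X).Colorable (n + m))
    (hY : (G.induce Y).Colorable m) : ¬ (G.induce (X \ Y)).Colorable n := fun h =>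
  hX (colorable_induce_mono (colorable_induce_union h hY) (by simp) le_rfl)

theorem nonempty_of_not_colorable_induce {n : ℕ} {X : Set V}
    (hX : ¬ (G.induce X).Colorable n) : X.Nonempty := by
  by_contra h
  have : IsEmpty X := Set.isEmpty_coe_sort.2 (Set.not_nonempty_iff_eq_empty.1 h)
  exact hX (.of_isEmpty n)

theorem colorable_induce_one_of_isIndepSet {S : Set V} (hS : G.IsIndepSet S) :
    (G.induce S).Colorable 1 :=
  colorable_induce_of_ne (fun _ => ()) fun _ hx _ hy hxy => absurd hxy (hS hx hy hxy.ne)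

theorem exists_adj_of_not_colorable_induce_one {X : Set V} (hX : ¬ (G.induce X).Colorable 1) :
    ∃ u ∈ X, ∃ v ∈ X, G.Adj u v := by
  by_contra! h
  exact hX (colorable_induce_one_of_isIndepSet fun x hx y hy _ => h x hx y hy)

theorem exists_fibre_not_colorable {n : ℕ} {X : Set V} {f : V → ℕ}
    (hf : ∀ x ∈ X, ∀ y ∈ X, G.Adj x y → f x ≤ f y + 1) (hX : ¬ (G.induce X).Colorable (2 * n)) :
    ∃ k, ¬ (G.induce {x ∈ X | f x = k}).Colorable n := by
  by_contra! h
  let C : ∀ k, (G.induce {x ∈ X | f x = k}).Coloring (Fin n) := fun k => (h k).some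
  -- consecutive fibres get disjoint palettes, chosen by the parity of `f`
  let κ : X → Bool × Fin n := fun x => ((f x).bodd, C (f x) ⟨x, x.2, rfl⟩)
  have hκ : ∀ {x y}, (G.induce X).Adj x y → κ x ≠ κ y := by
    intro x y hxy heq
    have hxy' : G.Adj x y := hxy
    have hle := hf x x.2 y y.2 hxy
    have hle' := hf y y.2 x x.2 hxy.symm
    have hbodd : (f x).bodd = (f y).bodd := (Prod.ext_iff.1 heq).1
    have hpar : f x % 2 = f y % 2 := by rw [Nat.mod_two_of_bodd, Nat.mod_two_of_bodd, hbodd]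
    have hfxy : f x = f y := by omega
    have hC : ∀ k (hk : f y = k), C (f y) ⟨y, y.2, rfl⟩ = C k ⟨y, y.2, hk⟩ := by
      rintro _ rfl
      rfl
    exact (C (f x)).valid (v := ⟨x, x.2, rfl⟩) (w := ⟨y, y.2, hfxy.symm⟩) hxy'
      ((Prod.ext_iff.1 heq).2.trans (hC _ hfxy.symm))
  exact hX (by simpa using (Coloring.mk κ hκ).colorable)

theorem exists_parity_not_colorable {n : ℕ} {X : Set V} (f : V → ℕ)
    (hX : ¬ (G.induce X).Colorable (2 * n)) :
    ∃ r, ¬ (G.induce {x ∈ X | f x % 2 = r}).Colorable n := by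
  by_contra! h
  refine hX (colorable_induce_mono (colorable_induce_union (h 0) (h 1)) (fun x hx => ?_)
    (two_mul n).ge)
  exact (Nat.mod_two_eq_zero_or_one (f x)).imp (And.intro hx) (And.intro hx)

theorem exists_component_not_colorable {n : ℕ} {X : Set V} (hX : ¬ (G.induce X).Colorable n) :
    ∃ C ⊆ X, (G.induce C).Connected ∧ ¬ (G.induce C).Colorable n ∧
      ∀ x ∈ C, ∀ y ∈ X, G.Adj x y → y ∈ C := by
  rw [colorable_iff_forall_connectedComponent] at hX
  push Not at hX
  obtain ⟨K, hK⟩ := hX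
  let φ : K.toSimpleGraph →g G.induce (Subtype.val '' K.supp) :=
    ⟨fun x => ⟨x.1, x.1, x.2, rfl⟩, id⟩
  have hφ : Function.Surjective φ := by
    rintro ⟨_, x, hx, rfl⟩
    exact ⟨⟨x, hx⟩, rfl⟩
  refine ⟨Subtype.val '' K.supp, by simp, K.connected_toSimpleGraph.map φ hφ,
    fun h => hK (h.of_hom φ), ?_⟩
  rintro _ ⟨x, hx, rfl⟩ y hy hxy
  exact ⟨⟨y, hy⟩, K.mem_supp_of_adj_mem_supp hx hxy, rfl⟩

theorem exists_adj_of_connected_induce {X C : Set V} (hX : (G.induce X).Connected) {x y : V}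
    (hx : x ∈ X) (hxC : x ∈ C) (hy : y ∈ X) (hyC : y ∉ C) :
    ∃ a ∈ X, a ∈ C ∧ ∃ b ∈ X, b ∉ C ∧ G.Adj a b := by
  obtain ⟨p⟩ := hX.preconnected ⟨x, hx⟩ ⟨y, hy⟩
  obtain ⟨d, -, hd, hd'⟩ := p.exists_boundary_dart (Subtype.val ⁻¹' C) hxC hyC
  exact ⟨d.fst, d.fst.2, hd, d.snd, d.snd.2, hd', d.adj⟩

theorem exists_component_diff {n m : ℕ} {X Y : Set V} (hX : (G.induce X).Connected)
    (hcol : ¬ (G.induce X).Colorable (n + m)) (hY : (G.induce Y).Colorable m) {v : V}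
    (hvX : v ∈ X) (hvY : v ∈ Y) :
    ∃ C ⊆ X \ Y, (G.induce C).Connected ∧ ¬ (G.induce C).Colorable n ∧
      ∃ b ∈ X ∩ Y, ∃ x ∈ C, G.Adj b x := by
  obtain ⟨C, hC, hconn, hcolC, hclosed⟩ :=
    exists_component_not_colorable (not_colorable_induce_diff hcol hY)
  obtain ⟨x, hx⟩ := nonempty_of_not_colorable_induce hcolC
  obtain ⟨a, -, ha, b, hb, hbC, hab⟩ :=
    exists_adj_of_connected_induce hX (hC hx).1 hx hvX fun h => (hC h).2 hvY
  refine ⟨C, hC, hconn, hcolC, b, ⟨hb, ?_⟩, a, ha, hab.symm⟩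
  by_contra hbY
  exact hbC (hclosed a ha b ⟨hb, hbY⟩ hab)

theorem exists_component_outside_ball (hG : G.Connected) {n m r : ℕ} {X : Set V} {v : V}
    (hX : (G.induce X).Connected) (hcol : ¬ (G.induce X).Colorable (n + m))
    (hball : (G.induce {x | G.dist v x ≤ r}).Colorable m) (hv : v ∈ X) :
    ∃ C ⊆ X, (G.induce C).Connected ∧ ¬ (G.induce C).Colorable n ∧ (∀ x ∈ C, r < G.dist v x) ∧
      ∃ b ∈ X, G.dist v b = r ∧ ∃ x ∈ C, G.Adj b x := by
  obtain ⟨C, hC, hconn, hcolC, b, ⟨hbX, hb⟩, x, hx, hbx⟩ :=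
    exists_component_diff hX hcol hball hv (by simp)
  have hlt : ∀ x ∈ C, r < G.dist v x := fun x hx => not_le.1 (hC hx).2
  refine ⟨C, fun x hx => (hC hx).1, hconn, hcolC, hlt, b, hbX, le_antisymm hb ?_, x, hx, hbx⟩
  have htri := hG.dist_triangle (u := v) (v := b) (w := x)
  rw [dist_eq_one_iff_adj.2 hbx] at htri
  have := hlt x hx
  omega

theorem exists_adj_connected_ge {n : ℕ} {F : Set V} (ℓ : V → ℕ)
    (hF : ¬ (G.induce F).Colorable (n + 1)) :
    ∃ u ∈ F, ∃ v ∈ F, ∃ X ⊆ F, G.Adj u v ∧ (G.induce X).Connected ∧ v ∈ X ∧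
      ¬ (G.induce X).Colorable n ∧ ℓ u ≤ ℓ v ∧ ∀ x ∈ X, ℓ v ≤ ℓ x := by
  let A : Set V := {v | ∃ X ⊆ F, (G.induce X).Connected ∧ v ∈ X ∧ ¬ (G.induce X).Colorable n ∧
    ∀ x ∈ X, ℓ v ≤ ℓ x}
  have hAF : A ⊆ F := fun _ ⟨_, hX, _, hv, _⟩ => hX hv
  have hcol : (G.induce (F \ A)).Colorable n := by
    by_contra h
    obtain ⟨C, hC, hconn, hcolC, -⟩ := exists_component_not_colorable h
    obtain ⟨v, hv, hmin⟩ := exists_minimalFor_of_wellFoundedLT (· ∈ C) ℓ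
      (nonempty_of_not_colorable_induce hcolC)
    exact (hC hv).2 ⟨C, fun y hy => (hC hy).1, hconn, hv, hcolC, fun y hy =>
      (le_total (ℓ v) (ℓ y)).elim id fun h => hmin hy h⟩
  have hA : ¬ (G.induce A).Colorable 1 := fun h =>
    hF (colorable_induce_mono (colorable_induce_union hcol h) (by simp) le_rfl)
  obtain ⟨u, hu, v, hv, huv⟩ := exists_adj_of_not_colorable_induce_one hA
  wlog h : ℓ u ≤ ℓ v generalizing u v
  · exact this v hv u hu huv.symm (le_of_not_ge h)
  obtain ⟨X, hX, hc, hvX, hn, hl⟩ := hv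
  exact ⟨u, hAF hu, v, hX hvX, X, hX, huv, hc, hvX, hn, h, hl⟩

/-! ### Flexible segments -/

theorem exists_geodesic {u v : V} (h : G.Reachable u v) :
    ∃ p : G.Walk u v, p.length = G.dist u v ∧ ∀ i ≤ p.length, G.dist u (p.getVert i) = i := by
  obtain ⟨p, hp⟩ := h.exists_walk_length_eq_dist
  refine ⟨p, hp, fun i hi => ?_⟩
  rw [← length_eq_dist_of_subwalk hp (p.isSubwalk_take i), Walk.take_length, min_eq_left hi]

theorem exists_geodesic_support (hG : G.Connected) (u v : V) :
    ∃ p : G.Walk u v, ∀ x ∈ p.support, G.dist u x + G.dist x v = G.dist u v := by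
  obtain ⟨p, hp, hdist⟩ := exists_geodesic (hG u v)
  refine ⟨p, fun x hx => ?_⟩
  obtain ⟨i, rfl, hi⟩ := Walk.mem_support_iff_exists_getVert.1 hx
  have hdrop : G.dist (p.getVert i) v ≤ p.length - i :=
    (dist_le (p.drop i)).trans_eq (p.drop_length i)
  have htri := hG.dist_triangle (u := u) (v := p.getVert i) (w := v)
  have hi' := hdist i hi
  omega

/-- The distance of `x` from `c` in the subgraph of `G` induced by `E`, with the junk value `0` for
vertices that are not in the component of `c`. -/
noncomputable def inducedDist (G : SimpleGraph V) (E : Set V) (c x : V) : ℕ :=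
  (G.induce E).spanningCoe.dist c x

section InducedDist

variable {E : Set V} {c : V}

theorem inducedDist_self : inducedDist G E c c = 0 :=
  dist_self

theorem inducedDist_le_add_one {x y : V} (hx : x ∈ E) (hy : y ∈ E) (hxy : G.Adj x y) :
    inducedDist G E c x ≤ inducedDist G E c y + 1 := by
  have hadj : (G.induce E).spanningCoe.Adj y x := by simp [hx, hy, hxy.symm]
  have := hadj.diff_dist_adj (u := c)
  unfold inducedDist
  omega

theorem exists_walk_inducedDist (hE : (G.induce E).Preconnected) (hc : c ∈ E) {m : V}
    (hm : m ∈ E) : ∃ p : G.Walk c m, p.length = inducedDist G E c m ∧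
      ∀ i ≤ p.length, p.getVert i ∈ E ∧ inducedDist G E c (p.getVert i) = i := by
  have hreach : (G.induce E).spanningCoe.Reachable c m :=
    (hE ⟨c, hc⟩ ⟨m, hm⟩).map (Embedding.spanningCoe _).toHom
  obtain ⟨p, hp, hdist⟩ := exists_geodesic hreach
  refine ⟨p.mapLe (spanningCoe_induce_le G E), by simpa [inducedDist] using hp, fun i hi => ?_⟩
  rw [Walk.length_mapLe] at hi
  rw [show (p.mapLe (spanningCoe_induce_le G E)).getVert i = p.getVert i from Walk.getVert_map ..]
  refine ⟨?_, hdist i hi⟩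
  cases i with
  | zero => simpa using hc
  | succ i => exact Subgraph.mem_of_adj_spanningCoe _ (p.adj_getVert_succ hi).symm

theorem exists_adj_inducedDist_lt (hE : (G.induce E).Preconnected) (hc : c ∈ E) {m : V}
    (hm : m ∈ E) (h : m ≠ c) :
    ∃ x ∈ E, G.Adj x m ∧ inducedDist G E c x < inducedDist G E c m := by
  obtain ⟨p, hp, hdist⟩ := exists_walk_inducedDist hE hc hm
  have hpos : 0 < p.length := Nat.pos_of_ne_zero fun h0 => h (Walk.eq_of_length_eq_zero h0).symm
  obtain ⟨hx, hxi⟩ := hdist (p.length - 1) (by omega)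
  have hadj := p.adj_getVert_succ (i := p.length - 1) (by omega)
  rw [Nat.sub_add_cancel hpos, Walk.getVert_length] at hadj
  exact ⟨_, hx, hadj, by omega⟩

end InducedDist

/-- The sequence `o 0, …, o n` is an induced path of `G`. -/
structure IsInducedPath (G : SimpleGraph V) (o : ℕ → V) (n : ℕ) : Prop where
  ne : ∀ i j, i < j → j ≤ n → o i ≠ o j
  adj_iff : ∀ i j, i < j → j ≤ n → (G.Adj (o i) (o j) ↔ j = i + 1)

theorem exists_isInducedPath {J : Set V} (hJ : (G.induce J).Preconnected) {c b : V} (hc : c ∈ J)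
    (hb : b ∈ J) : ∃ (n : ℕ) (τ : ℕ → V), IsInducedPath G τ n ∧ τ 0 = c ∧ τ n = b ∧
      ∀ i ≤ n, τ i ∈ J := by
  obtain ⟨p, -, hp⟩ := exists_walk_inducedDist hJ hc hb
  refine ⟨p.length, p.getVert, ⟨fun i j hij hj h => ?_, fun i j hij hj => ⟨fun h => ?_, ?_⟩⟩,
    p.getVert_zero, p.getVert_length, fun i hi => (hp i hi).1⟩
  · have hi := (hp i (by omega)).2
    rw [h, (hp j hj).2] at hi
    omega
  · obtain ⟨hiJ, hi⟩ := hp i (by omega)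
    obtain ⟨hjJ, hj⟩ := hp j hj
    have := inducedDist_le_add_one (c := c) hjJ hiJ h.symm
    omega
  · rintro rfl
    exact p.adj_getVert_succ hj

namespace IsInducedPath

variable {o τ : ℕ → V} {n m : ℕ}

theorem even_of_forall_odd {J : Set V} (hτ : IsInducedPath G τ n) (hJ : ∀ i ≤ n, τ i ∈ J)
    {κ : V → ℕ} (hκ : ∀ x ∈ J, ∀ y ∈ J, G.Adj x y → Odd (κ x + κ y)) :
    Even (n + κ (τ 0) + κ (τ n)) := by
  have hstep : ∀ i ≤ n, Even (i + κ (τ 0) + κ (τ i)) := by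
    intro i hi
    induction i with
    | zero => simp
    | succ i ih =>
      specialize ih (by omega)
      have hodd := hκ _ (hJ i (by omega)) _ (hJ (i + 1) hi)
        ((hτ.adj_iff i (i + 1) (by omega) hi).2 rfl)
      grind
  exact hstep n le_rfl

theorem append (ho : IsInducedPath G o n) (hτ : IsInducedPath G τ m) (h0 : o n = τ 0)
    (hc : ∀ i < n, ∀ j, 1 ≤ j → j ≤ m → o i ≠ τ j ∧ ¬ G.Adj (o i) (τ j)) :
    IsInducedPath G (fun k => if k ≤ n then o k else τ (k - n)) (n + m) where
  ne i j hij hj := by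
    split_ifs with h1 h2 h2
    · exact ho.ne i j hij h2
    · rcases Nat.lt_or_ge i n with h | h
      · exact (hc i h (j - n) (by omega) (by omega)).1
      · rw [show i = n by omega, h0]
        exact hτ.ne _ _ (by omega) (by omega)
    · omega
    · exact hτ.ne _ _ (by omega) (by omega)
  adj_iff i j hij hj := by
    split_ifs with h1 h2 h2
    · exact ho.adj_iff i j hij h2
    · rcases Nat.lt_or_ge i n with h | _
      · exact iff_of_false (hc i h (j - n) (by omega) (by omega)).2 (by omega)
      · rw [show i = n by omega, h0, hτ.adj_iff _ _ (by omega) (by omega)]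
        omega
    · omega
    · rw [hτ.adj_iff _ _ (by omega) (by omega)]
      omega

theorem close (ho : IsInducedPath G o n) (hτ : IsInducedPath G τ m) (h0 : o n = τ 0)
    (h1 : τ m = o 0) (hn : 1 ≤ n) (hm : 2 ≤ m)
    (hc : ∀ i, 0 < i → i < n → ∀ j, 0 < j → j < m → o i ≠ τ j ∧ ¬ G.Adj (o i) (τ j)) :
    IsInducedCycle G (fun k => if k ≤ n then o k else τ (k - n)) (n + m) := by
  have hne : ∀ i j, i < j → j < n + m →
      (if i ≤ n then o i else τ (i - n)) ≠ if j ≤ n then o j else τ (j - n) := by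
    intro i j hij hj
    split_ifs with h2 h3 h3
    · exact ho.ne i j hij h3
    · obtain rfl | hi | rfl : i = 0 ∨ (0 < i ∧ i < n) ∨ i = n := by omega
      · rw [← h1]
        exact (hτ.ne _ _ (by omega) (by omega)).symm
      · exact (hc i hi.1 hi.2 (j - n) (by omega) (by omega)).1
      · rw [h0]
        exact hτ.ne _ _ (by omega) (by omega)
    · omega
    · exact hτ.ne _ _ (by omega) (by omega)
  refine ⟨?_, fun i hi j hj h => ?_, fun i j hij hj => ?_⟩
  · simp [show ¬ n + m ≤ n by omega, h1]
  · by_contra hij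
    rcases Nat.lt_or_gt_of_ne hij with hlt | hlt
    · exact hne i j hlt hj h
    · exact hne j i hlt hi h.symm
  · split_ifs with h2 h3 h3
    · rw [ho.adj_iff i j hij h3]
      omega
    · obtain rfl | hi | rfl : i = 0 ∨ (0 < i ∧ i < n) ∨ i = n := by omega
      · rw [← h1, G.adj_comm, hτ.adj_iff _ _ (by omega) (by omega)]
        omega
      · exact iff_of_false (hc i hi.1 hi.2 (j - n) (by omega) (by omega)).2 (by omega)
      · rw [h0, hτ.adj_iff _ _ (by omega) (by omega)]
        omega
    · omega
    · rw [hτ.adj_iff _ _ (by omega) (by omega)]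
      omega

end IsInducedPath

theorem exists_closed_walk_of_dist_eq (hG : G.Connected) {c x y : V} (hxy : G.Adj x y)
    (hdist : G.dist c x = G.dist c y) :
    ∃ p : G.Walk c c, p.length = 2 * G.dist c x + 1 ∧ ∀ z ∈ p.support, G.dist c z ≤ G.dist c x := by
  obtain ⟨p, hp⟩ := hG.exists_walk_length_eq_dist c x
  obtain ⟨q, hq⟩ := hG.exists_walk_length_eq_dist c y
  have hball : ∀ {w} (r : G.Walk c w), ∀ z ∈ r.support, G.dist c z ≤ r.length := by
    intro w r z hz
    obtain ⟨i, rfl, _⟩ := Walk.mem_support_iff_exists_getVert.1 hz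
    exact (dist_le (r.take i)).trans (by simp)
  refine ⟨(p.concat hxy).append q.reverse, by simp; omega, fun z hz => ?_⟩
  rw [Walk.mem_support_append_iff, Walk.support_concat, List.mem_append,
    List.mem_singleton, Walk.support_reverse, List.mem_reverse] at hz
  rcases hz with (hz | rfl) | hz
  · exact hp ▸ hball p z hz
  · exact hdist.ge
  · exact (hball q z hz).trans_eq (hq.trans hdist.symm)

/-- The distances of `G` dominate a function `δ` whose balls of radius `100` are bipartite. It is
used for the distance `δ` of a larger graph that contains `G` as an induced subgraph. -/
structure IsLocallyBipartite (G : SimpleGraph V) (δ : V → V → ℕ) : Prop where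
  le_dist : ∀ x y, δ x y ≤ G.dist x y
  le_add_dist : ∀ x y z, δ x z ≤ δ x y + G.dist y z
  colorable_ball : ∀ c, (G.induce {x | δ c x ≤ 100}).Colorable 2

namespace IsLocallyBipartite

variable {δ : V → V → ℕ}

theorem colorable_dist_ball (hδ : IsLocallyBipartite G δ) {r : ℕ} (hr : r ≤ 100) (c : V) :
    (G.induce {x | G.dist c x ≤ r}).Colorable 2 :=
  colorable_induce_mono (hδ.colorable_ball c)
    (fun x hx => (hδ.le_dist c x).trans (le_trans hx hr)) le_rfl

theorem odd_dist_add_dist (hG : G.Connected) (hδ : IsLocallyBipartite G δ) {c x y : V}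
    (hx : G.dist c x ≤ 100) (hxy : G.Adj x y) : Odd (G.dist c x + G.dist c y) := by
  have hne : G.dist c x ≠ G.dist c y := by
    intro h
    obtain ⟨p, hp, hsupp⟩ := exists_closed_walk_of_dist_eq hG hxy h
    have heven := two_colorable_iff_forall_loop_even.1 (hδ.colorable_dist_ball hx c) _
      (p.induce {z | G.dist c z ≤ G.dist c x} hsupp)
    have hlen : (p.induce {z | G.dist c z ≤ G.dist c x} hsupp).length = p.length :=
      (Walk.length_map _ _).symm.trans (congrArg Walk.length (p.map_induce hsupp))
    rw [hlen, hp] at heven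
    exact Nat.not_even_bit1 _ heven
  have := hxy.diff_dist_adj (u := c)
  grind

theorem even_dist_add_dist_add_dist (hG : G.Connected) (hδ : IsLocallyBipartite G δ) {x y v : V}
    (hyv : y = v ∨ G.Adj y v) (hx : G.dist y x ≤ 100) :
    Even (G.dist v x + G.dist y x + G.dist v y) := by
  rcases hyv with rfl | h
  · simp
  · have hodd := hδ.odd_dist_add_dist hG (c := x) (dist_comm.trans_le hx) h
    rw [dist_comm, dist_comm (u := x)] at hodd
    rw [dist_eq_one_iff_adj.2 h.symm]
    grind

end IsLocallyBipartite

/-- The lowest level, measured by `inducedDist` from `c` inside `E`, on which `E` has a vertex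
within distance `ρ` of `x`; the junk value is `0` if there is no such vertex. -/
noncomputable def lowestLevel (G : SimpleGraph V) (E : Set V) (c : V) (ρ : ℕ) (x : V) : ℕ :=
  sInf {a | ∃ m ∈ E, inducedDist G E c m = a ∧ G.dist x m ≤ ρ}

theorem lowestLevel_le {E : Set V} {c : V} {ρ : ℕ} {x m : V} (hm : m ∈ E) (h : G.dist x m ≤ ρ) :
    lowestLevel G E c ρ x ≤ inducedDist G E c m :=
  Nat.sInf_le ⟨m, hm, rfl, h⟩

theorem le_dist_of_adj_of_inducedDist_lt (hG : G.Connected) {E : Set V} {c : V} {ρ : ℕ}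
    {w x z : V} (hz : z ∈ E) (hxz : G.Adj x z)
    (hlt : inducedDist G E c z < lowestLevel G E c ρ w) : ρ ≤ G.dist w x := by
  by_contra! hwx
  have htri : G.dist w z ≤ G.dist w x + G.dist x z := hG.dist_triangle
  rw [dist_eq_one_iff_adj.2 hxz] at htri
  exact hlt.not_ge (lowestLevel_le hz (htri.trans hwx))

theorem exists_inducedDist_eq_lowestLevel (hG : G.Connected) {E : Set V} {c : V}
    (hE : (G.induce E).Preconnected) (hc : c ∈ E) {ρ : ℕ} {x : V} (hx : x ∈ E)
    (hxc : ρ < G.dist x c) :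
    ∃ m ∈ E, inducedDist G E c m = lowestLevel G E c ρ x ∧ G.dist x m = ρ := by
  obtain ⟨m, hm, hlevel, hdist⟩ := Nat.sInf_mem
    (s := {a | ∃ m ∈ E, inducedDist G E c m = a ∧ G.dist x m ≤ ρ}) ⟨_, x, hx, rfl, by simp⟩
  refine ⟨m, hm, hlevel, hdist.antisymm <| not_lt.1 fun hlt => ?_⟩
  have hmc : m ≠ c := fun h => (h ▸ hdist).not_gt hxc
  obtain ⟨m', hm', hadj, hlt'⟩ := exists_adj_inducedDist_lt hE hc hm hmc
  have htri := hG.dist_triangle (u := x) (v := m) (w := m')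
  rw [dist_eq_one_iff_adj.2 hadj.symm] at htri
  exact ((lowestLevel_le hm' (by omega)).trans_lt hlt').ne hlevel.symm

theorem exists_connected_near_geodesics (hG : G.Connected) {ρ R : ℕ} (hρR : ρ + 2 ≤ R)
    (hRρ : R + 2 ≤ 2 * ρ) {y v b m : V} (hyv : G.dist v y ≤ 1) (hym : G.dist y m = ρ)
    (hvb : G.dist v b = R) :
    ∃ L : Set V, (G.induce L).Connected ∧ m ∈ L ∧ b ∈ L ∧ (∀ x ∈ L, G.dist v x < R ∨ x = b) ∧
      ∀ x ∈ L, x = m ∨ G.dist y x < ρ ∨ G.dist v x < ρ ∨ G.dist b x < ρ := by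
  obtain ⟨p, hp⟩ := exists_geodesic_support hG v y
  obtain ⟨q, hq⟩ := exists_geodesic_support hG y m
  obtain ⟨r, hr⟩ := exists_geodesic_support hG v b
  let w := r.reverse.append (p.append q)
  refine ⟨{x | x ∈ w.support}, w.connected_induce_support, by simp, by simp, fun x hx => ?_,
    fun x hx => ?_⟩
  all_goals
    simp only [w, Set.mem_ofPred_eq, Walk.mem_support_append_iff, Walk.support_reverse,
      List.mem_reverse] at hx
  · rcases hx with hx | hx | hx
    · have := hr x hx
      rcases Nat.eq_zero_or_pos (G.dist x b) with h | _
      · exact Or.inr (hG.dist_eq_zero_iff.1 h)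
      · omega
    · have := hp x hx
      omega
    · have := hq x hx
      have := hG.dist_triangle (u := v) (v := y) (w := x)
      omega
  · rcases hx with hx | hx | hx
    · have := hr x hx
      rw [dist_comm (u := b)]
      omega
    · have := hp x hx
      omega
    · have := hq x hx
      rcases Nat.eq_zero_or_pos (G.dist x m) with h | _
      · exact Or.inl (hG.dist_eq_zero_iff.1 h)
      · omega

theorem exists_isInducedPath_union {T L : Set V} {κ₁ κ₂ : V → ℕ} {c b m : V}
    (hT : (G.induce T).Connected) (hL : (G.induce L).Connected)
    (hκ₁ : ∀ x ∈ T, ∀ y ∈ T, G.Adj x y → Odd (κ₁ x + κ₁ y))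
    (hκ₂ : ∀ x ∈ L, ∀ y ∈ L, G.Adj x y → Odd (κ₂ x + κ₂ y)) (hmT : m ∈ T) (hmL : m ∈ L)
    (hm : Even (κ₁ m + κ₂ m)) (hcontact : ∀ x ∈ L, ∀ y ∈ T, y ∉ L → G.Adj x y → x = m)
    (hcT : c ∈ T) (hcL : c ∉ L) (hbL : b ∈ L) :
    ∃ (n : ℕ) (τ : ℕ → V), IsInducedPath G τ n ∧ τ 0 = c ∧ τ n = b ∧ (∀ i ≤ n, τ i ∈ T ∪ L) ∧
      Even (n + κ₁ c + κ₂ b) := by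
  classical
  let κ : V → ℕ := fun x => if x ∈ L then κ₂ x else κ₁ x
  have hmixed : ∀ x ∈ L, ∀ y ∈ T, y ∉ L → G.Adj x y → Odd (κ₂ x + κ₁ y) := by
    intro x hx y hy hyL hxy
    obtain rfl := hcontact x hx y hy hyL hxy
    have hodd := hκ₁ x hmT y hy hxy
    grind
  have hκ : ∀ x ∈ T ∪ L, ∀ y ∈ T ∪ L, G.Adj x y → Odd (κ x + κ y) := by
    intro x hx y hy hxy
    simp only [κ]
    split_ifs with hxL hyL hyL
    · exact hκ₂ x hxL y hyL hxy
    · exact hmixed x hxL y (hy.resolve_right hyL) hyL hxy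
    · exact add_comm (κ₂ y) _ ▸ hmixed y hyL x (hx.resolve_right hxL) hxL hxy.symm
    · exact hκ₁ x (hx.resolve_right hxL) y (hy.resolve_right hyL) hxy
  obtain ⟨n, τ, hτ, h0, hn, hmem⟩ := exists_isInducedPath
    (induce_union_connected hT.preconnected hL.preconnected ⟨m, hmT, hmL⟩).preconnected
    (Or.inl hcT) (Or.inr hbL)
  have heven := hτ.even_of_forall_odd hmem hκ
  rw [h0, hn] at heven
  simp only [κ, if_neg hcL, if_pos hbL] at heven
  exact ⟨n, τ, hτ, h0, hn, hmem, heven⟩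

theorem exists_walk_odd_inducedDist {E : Set V} {c m : V} (hE : (G.induce E).Preconnected)
    (hc : c ∈ E) (hm : m ∈ E) :
    ∃ p : G.Walk c m,
      (∀ x ∈ p.support, x ∈ E ∧ (x = m ∨ inducedDist G E c x < inducedDist G E c m)) ∧
      ∀ x ∈ p.support, ∀ y ∈ p.support, G.Adj x y →
        Odd (inducedDist G E c x + inducedDist G E c y) := by
  obtain ⟨p, hlen, hp⟩ := exists_walk_inducedDist hE hc hm
  refine ⟨p, fun x hx => ?_, fun x hx y hy hxy => ?_⟩
  · obtain ⟨i, rfl, hi⟩ := Walk.mem_support_iff_exists_getVert.1 hx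
    obtain ⟨hxE, hxi⟩ := hp i hi
    rcases hi.lt_or_eq with h | rfl
    · exact ⟨hxE, Or.inr (by omega)⟩
    · exact ⟨hxE, Or.inl p.getVert_length⟩
  · obtain ⟨i, rfl, hi⟩ := Walk.mem_support_iff_exists_getVert.1 hx
    obtain ⟨j, rfl, hj⟩ := Walk.mem_support_iff_exists_getVert.1 hy
    have hij : i ≠ j := fun h => hxy.ne (h ▸ rfl)
    obtain ⟨hxE, hxi⟩ := hp i hi
    obtain ⟨hyE, hyj⟩ := hp j hj
    have := inducedDist_le_add_one (c := c) hxE hyE hxy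
    have := inducedDist_le_add_one (c := c) hyE hxE hxy.symm
    grind

theorem exists_segment (hG : G.Connected) {δ : V → V → ℕ} (hδ : IsLocallyBipartite G δ)
    {E : Set V} {c y v b : V} (hE : (G.induce E).Preconnected) (hc : c ∈ E) (hyE : y ∈ E)
    {ρ R : ℕ} (hρR : ρ + 2 ≤ R) (hRρ : R + 2 ≤ 2 * ρ) (hR : R ≤ 100) (hyv : y = v ∨ G.Adj y v)
    (hv : lowestLevel G E c ρ y ≤ lowestLevel G E c ρ v)
    (hb : lowestLevel G E c ρ y ≤ lowestLevel G E c ρ b)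
    (hyc : ρ < G.dist y c) (hvc : R < G.dist v c) (hvb : G.dist v b = R) :
    ∃ (n : ℕ) (τ : ℕ → V), IsInducedPath G τ n ∧ τ 0 = c ∧ τ n = b ∧
      (∀ i ≤ n, (τ i ∈ E ∧ inducedDist G E c (τ i) < lowestLevel G E c ρ y) ∨
        ((G.dist v (τ i) < R ∨ τ i = b) ∧ ∃ w, (w = y ∨ w = v ∨ w = b) ∧ G.dist w (τ i) ≤ ρ)) ∧
      Even (n + lowestLevel G E c ρ y + ρ + G.dist v y + R) := by
  set ℓ := lowestLevel G E c ρ y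
  obtain ⟨m, hm, hlevel, hym⟩ := exists_inducedDist_eq_lowestLevel hG hE hc hyE hyc
  have hvy : G.dist v y ≤ 1 := by
    rcases hyv with rfl | h
    · simp
    · exact (dist_eq_one_iff_adj.2 h.symm).le
  obtain ⟨L, hL, hmL, hbL, hLv, hLnear⟩ := exists_connected_near_geodesics hG hρR hRρ hvy hym hvb
  obtain ⟨p, hpE, hpodd⟩ := exists_walk_odd_inducedDist hE hc hm
  have hLR : ∀ x ∈ L, G.dist v x ≤ R := fun x hx =>
    (hLv x hx).elim le_of_lt fun h => (h ▸ hvb).le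
  have hmeven := hδ.even_dist_add_dist_add_dist hG hyv (x := m) (by omega)
  rw [hym] at hmeven
  have hcontact : ∀ x ∈ L, ∀ z ∈ {z | z ∈ p.support}, z ∉ L → G.Adj x z → x = m := by
    intro x hx z hz hzL hxz
    obtain ⟨hzE, hzm⟩ := hpE z hz
    have hlt := hzm.resolve_left fun h => hzL (h ▸ hmL)
    have hfar (w) (hw : ℓ ≤ lowestLevel G E c ρ w) : ρ ≤ G.dist w x :=
      le_dist_of_adj_of_inducedDist_lt hG hzE hxz ((hlt.trans_eq hlevel).trans_le hw)
    have := hfar y le_rfl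
    have := hfar v hv
    have := hfar b hb
    exact (hLnear x hx).resolve_right (by omega)
  obtain ⟨n, τ, hτ, h0, hn, hmem, heven⟩ := exists_isInducedPath_union
    (κ₁ := fun x => inducedDist G E c x + (ℓ + ρ + G.dist v y)) (κ₂ := G.dist v)
    p.connected_induce_support hL (fun x hx z hz hxz => by have := hpodd x hx z hz hxz; grind)
    (fun x hx z _ hxz => hδ.odd_dist_add_dist hG ((hLR x hx).trans hR) hxz)
    p.end_mem_support hmL (by grind) hcontact p.start_mem_support
    (fun h => (hLR c h).not_gt hvc) hbL
  refine ⟨n, τ, hτ, h0, hn, fun i hi => ?_, by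
    rw [inducedDist_self, hvb] at heven; convert heven using 1; ring⟩
  by_cases h : τ i ∈ L
  · refine Or.inr ⟨hLv _ h, ?_⟩
    rcases hLnear _ h with h | h | h | h
    · exact ⟨y, by simp, h ▸ hym.le⟩
    · exact ⟨y, by simp, h.le⟩
    · exact ⟨v, by simp, h.le⟩
    · exact ⟨b, by simp, h.le⟩
  · obtain ⟨hE', hlt⟩ := hpE _ ((hmem i hi).resolve_right h)
    exact Or.inl ⟨hE', (hlt.resolve_left fun h' => h (h' ▸ hmL)).trans_eq hlevel⟩

theorem IsLocallyBipartite.colorable_iUnion_ball {δ : V → V → ℕ} (hδ : IsLocallyBipartite G δ)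
    (c : ℕ → V) (i : ℕ) : (G.induce {x | ∃ j ≤ i, δ (c j) x ≤ 100}).Colorable (2 * (i + 1)) := by
  induction i with
  | zero => exact colorable_induce_mono (hδ.colorable_ball (c 0)) (by simp) le_rfl
  | succ i ih =>
    refine colorable_induce_mono (colorable_induce_union ih (hδ.colorable_ball (c (i + 1)))) ?_
      (by omega)
    rintro x ⟨j, hj, hx⟩
    rcases hj.lt_or_eq with hj | rfl
    · exact Or.inl ⟨j, by omega, hx⟩
    · exact Or.inr hx

theorem connected_induce_insert {E : Set V} {c : V} (hE : (G.induce E).Connected)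
    (hc : ∃ x ∈ E, G.Adj c x) : (G.induce (insert c E)).Connected := by
  obtain ⟨x, hx, hcx⟩ := hc
  have hsingleton : (G.induce {c}).Preconnected := .of_subsingleton
  exact connected_induce_union hsingleton hE.preconnected (Set.mem_singleton c) hx hcx

/-- The set `Q` contains induced paths from `c` to `b` of both parities. -/
def IsFlexible (G : SimpleGraph V) (Q : Set V) (c b : V) : Prop :=
  ∀ s : ℕ, ∃ (n : ℕ) (τ : ℕ → V), IsInducedPath G τ n ∧ τ 0 = c ∧ τ n = b ∧ (∀ k ≤ n, τ k ∈ Q) ∧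
    Even (n + s)

/-- The set `Q` is a flexible segment from `c` to the new joint `b`. It runs through `E` until it
comes close to `v`, and it stays away from a connected set `C ⊆ E` that is attached to `b` and in
which the next segment can be found. -/
structure IsFlexibleSegment (G : SimpleGraph V) (E : Set V) (ρ : ℕ) (c v b : V) (C Q : Set V) :
    Prop where
  isFlexible : IsFlexible G Q c b
  center_mem : v ∈ E
  joint_mem : b ∈ E
  dist_joint : G.dist v b = 14
  connected : (G.induce C).Connected
  subset : C ⊆ E
  attached : ∃ x ∈ C, G.Adj b x
  lt_dist : ∀ x ∈ C, 14 < G.dist v x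
  cover : ∀ x ∈ Q, (x ∈ insert c E ∧ ∀ y ∈ C, ρ < G.dist y x) ∨
    ((G.dist v x < 14 ∨ x = b) ∧ ∃ w ∈ E, G.dist w x ≤ ρ)

theorem isFlexible_of_lowestLevel (hG : G.Connected) {δ : V → V → ℕ} (hδ : IsLocallyBipartite G δ)
    {E : Set V} {c u v b : V} {ρ : ℕ} (hE : (G.induce E).Preconnected) (hc : c ∈ E) (hu : u ∈ E)
    (hv : v ∈ E) (hρ : 8 ≤ ρ) (hρ' : ρ ≤ 12) (huv : G.Adj u v)
    (hpar : lowestLevel G E c ρ u % 2 = lowestLevel G E c ρ v % 2)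
    (hule : lowestLevel G E c ρ u ≤ lowestLevel G E c ρ v)
    (hble : lowestLevel G E c ρ v ≤ lowestLevel G E c ρ b)
    (huc : ρ < G.dist u c) (hvc : 14 < G.dist v c) (hvb : G.dist v b = 14) :
    IsFlexible G {x | (x ∈ E ∧ inducedDist G E c x < lowestLevel G E c ρ v) ∨
      ((G.dist v x < 14 ∨ x = b) ∧ ∃ w, (w = u ∨ w = v ∨ w = b) ∧ G.dist w x ≤ ρ)} c b := by
  -- The two segments that leave `E` next to `v` and next to `u` have lengths of opposite parity.
  obtain ⟨n, τ, hτ, h0, hn, hcover, heven⟩ := exists_segment hG hδ hE hc hv (R := 14)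
    (by omega) (by omega) (by omega) (Or.inl rfl) le_rfl hble (by omega) hvc hvb
  obtain ⟨n', τ', hτ', h0', hn', hcover', heven'⟩ := exists_segment hG hδ hE hc hu (R := 14)
    (by omega) (by omega) (by omega) (Or.inr huv) hule (hule.trans hble) huc hvc hvb
  rw [dist_self, Nat.even_iff] at heven
  rw [dist_eq_one_iff_adj.2 huv.symm, Nat.even_iff] at heven'
  intro s
  by_cases h : Even (n + s)
  · refine ⟨n, τ, hτ, h0, hn, fun k hk => (hcover k hk).imp_right ?_, h⟩
    exact And.imp_right fun ⟨w, hw, hwx⟩ => ⟨w, by tauto, hwx⟩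
  · refine ⟨n', τ', hτ', h0', hn', fun k hk => (hcover' k hk).imp_left ?_, ?_⟩
    · exact And.imp_right fun hlt => hlt.trans_le hule
    · rw [Nat.even_iff] at h ⊢
      omega

theorem exists_isFlexibleSegment (hG : G.Connected) {δ : V → V → ℕ} (hδ : IsLocallyBipartite G δ)
    {E Y : Set V} {c : V} {ρ n k : ℕ} (hE : (G.induce E).Connected) (hc : ∃ x ∈ E, G.Adj c x)
    (hρ : 8 ≤ ρ) (hρ' : ρ ≤ 12) (hY : (G.induce Y).Colorable k) (hYc : ∀ x ∉ Y, 14 < G.dist x c)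
    (hcol : ¬ (G.induce E).Colorable (2 * (n + 3) + k)) :
    ∃ (v b : V) (C Q : Set V), IsFlexibleSegment G E ρ c v b C Q ∧ v ∉ Y ∧
      (∀ x ∈ C, x ∉ Y) ∧ ¬ (G.induce C).Colorable n := by
  have hE' : (G.induce (insert c E)).Preconnected := (connected_induce_insert hE hc).preconnected
  set ℓ := lowestLevel G (insert c E) c ρ
  obtain ⟨r, hr⟩ := exists_parity_not_colorable ℓ (not_colorable_induce_diff hcol hY)
  obtain ⟨u, hu, v, hv, X, hXF, huv, hX, hvX, hXcol, hule, hXle⟩ :=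
    exists_adj_connected_ge (n := n + 2) ℓ hr
  obtain ⟨C, hCX, hC, hCcol, hlt, b, hbX, hvb, hbC⟩ := exists_component_outside_ball hG hX hXcol
    (hδ.colorable_dist_ball (r := 14) (by omega) v) hvX
  have hXE : ∀ x ∈ X, x ∈ E := fun x hx => (hXF hx).1.1
  have hflex := isFlexible_of_lowestLevel hG hδ hE' (Set.mem_insert c E) (Or.inr hu.1.1)
    (Or.inr hv.1.1) hρ hρ' huv (hu.2.trans hv.2.symm) hule (hXle b hbX)
    (by have := hYc u hu.1.2; omega) (hYc v hv.1.2) hvb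
  refine ⟨v, b, C, _, ⟨hflex, hv.1.1, hXE b hbX, hvb, hC, fun x hx => hXE x (hCX hx), hbC, hlt, ?_⟩,
    hv.1.2, fun x hx => (hXF (hCX hx)).1.2, hCcol⟩
  rintro x (⟨hx, hxlt⟩ | ⟨hx, w, hw, hwx⟩)
  · refine Or.inl ⟨hx, fun y hy => not_le.1 fun hyx => ?_⟩
    exact ((hXle y (hCX hy)).trans (lowestLevel_le hx hyx)).not_gt hxlt
  · refine Or.inr ⟨hx, w, ?_, hwx⟩
    rcases hw with rfl | rfl | rfl
    exacts [hu.1.1, hv.1.1, hXE w hbX]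

/-! ### Ropes -/

/-- The sequence `o` is an induced path inside `P` through the joints `c 0, …, c i`, which it passes
at the positions `p 0 = 0 < ⋯ < p i`; the position `p j` has the parity of `π j`. -/
structure IsStrand (G : SimpleGraph V) (c : ℕ → V) (i : ℕ) (π : ℕ → ℕ) (P : Set V) (o : ℕ → V)
    (p : ℕ → ℕ) : Prop where
  isInducedPath : IsInducedPath G o (p i)
  mem : ∀ k ≤ p i, o k ∈ P
  start : p 0 = 0
  joint : ∀ j ≤ i, o (p j) = c j
  lt_succ : ∀ j < i, p j < p (j + 1)
  even : ∀ j ≤ i, Even (p j + π j)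

namespace IsStrand

variable {c : ℕ → V} {i : ℕ} {π : ℕ → ℕ} {P Q : Set V} {o τ : ℕ → V} {p : ℕ → ℕ} {m : ℕ}

theorem strictMonoOn (h : IsStrand G c i π P o p) : StrictMonoOn p (Set.Iic i) :=
  strictMonoOn_of_lt_add_one Set.ordConnected_Iic fun j _ _ hj => h.lt_succ j hj

theorem snoc (h : IsStrand G c i π P o p) (hτ : IsInducedPath G τ m) (h0 : τ 0 = c i)
    (hm : 0 < m) (hQ : ∀ k ≤ m, τ k ∈ Q) (heven : Even (m + (π i + π (i + 1))))
    (hPQ : ∀ y ∈ P, y ≠ c i → ∀ q ∈ Q, q ≠ c i → y ≠ q ∧ ¬ G.Adj y q) :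
    IsStrand G (Function.update c (i + 1) (τ m)) (i + 1) π (P ∪ Q)
      (fun k => if k ≤ p i then o k else τ (k - p i)) (Function.update p (i + 1) (p i + m)) := by
  have hci : o (p i) = c i := h.joint i le_rfl
  have hpu : ∀ j ≤ i, Function.update p (i + 1) (p i + m) j = p j := fun j hj =>
    Function.update_of_ne (by omega) _ _
  refine ⟨?_, fun k hk => ?_, (hpu 0 (Nat.zero_le i)).trans h.start, fun j hj => ?_,
    fun j hj => ?_, fun j hj => ?_⟩
  · rw [Function.update_self]
    refine h.isInducedPath.append hτ (hci.trans h0.symm) fun a ha k hk hkm => ?_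
    refine hPQ _ (h.mem a ha.le) ?_ _ (hQ k hkm) ?_
    · exact hci ▸ h.isInducedPath.ne a _ ha le_rfl
    · exact h0 ▸ (hτ.ne 0 k hk hkm).symm
  · rw [Function.update_self] at hk
    split_ifs with hkp
    · exact Or.inl (h.mem k hkp)
    · exact Or.inr (hQ _ (by omega))
  · rcases hj.lt_or_eq with hj | rfl
    · have hj' : j ≤ i := by omega
      rw [hpu j hj', Function.update_of_ne hj.ne,
        if_pos (h.strictMonoOn.monotoneOn hj' Set.self_mem_Iic hj'), h.joint j hj']
    · simp [hm.ne']
  · rw [hpu j (by omega)]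
    rcases (Nat.lt_succ_iff.1 hj).lt_or_eq with hj | rfl
    · exact hpu (j + 1) (by omega) ▸ h.lt_succ j hj
    · rw [Function.update_self]
      omega
  · rcases hj.lt_or_eq with hj | rfl
    · exact hpu j (by omega) ▸ h.even j (by omega)
    · have := h.even i le_rfl
      rw [Function.update_self]
      grind

end IsStrand

/-- The joints `c 0, …, c i` of a rope are far apart with respect to `δ`, and its body `P` contains
induced paths that pass the joints at positions of prescribed parities.
The rope can be prolonged from `c i` into the connected set `E ⊆ A₀`. -/
structure IsRope (G : SimpleGraph V) (δ : V → V → ℕ) (A₀ : Set V) (i : ℕ) (c : ℕ → V)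
    (E P : Set V) : Prop where
  connected : (G.induce E).Connected
  subset : E ⊆ A₀
  attached : ∃ x ∈ E, G.Adj (c i) x
  one_lt_dist : ∀ x ∈ E, ∀ y ∈ P, y ≠ c i → 1 < G.dist x y
  cover : ∀ y ∈ P, y = c 0 ∨ (∃ j, 1 ≤ j ∧ j ≤ i ∧ G.dist (c j) y ≤ 28) ∨
    (y ∈ A₀ ∧ ∀ x ∈ E, 13 - i < G.dist x y)
  joint_mem : ∀ j, 1 ≤ j → j ≤ i → c j ∈ A₀
  lt_joint : ∀ j j', j < j' → j' ≤ i → 86 < δ (c j) (c j')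
  exists_isStrand : ∀ π : ℕ → ℕ, Even (π 0) → ∃ o p, IsStrand G c i π P o p

theorem isRope_zero {δ : V → V → ℕ} {A₀ : Set V} {c₀ : V} (hA₀ : (G.induce A₀).Connected)
    (hc₀ : ∃ x ∈ A₀, G.Adj c₀ x) : IsRope G δ A₀ 0 (fun _ => c₀) A₀ {c₀} where
  connected := hA₀
  subset := subset_rfl
  attached := hc₀
  one_lt_dist _ _ _ hy hne := absurd hy hne
  cover _ hy := Or.inl hy
  joint_mem := by omega
  lt_joint := by omega
  exists_isStrand π hπ := ⟨fun _ => c₀, fun _ => 0, ⟨by omega, by omega⟩, fun _ _ => rfl, rfl,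
    fun _ _ => rfl, by omega, by simpa using hπ⟩

theorem ne_and_not_adj_of_one_lt_dist {x y : V} (h : 1 < G.dist x y) : x ≠ y ∧ ¬ G.Adj x y := by
  refine ⟨?_, fun hxy => h.ne' (dist_eq_one_iff_adj.2 hxy)⟩
  rintro rfl
  simp at h

namespace IsRope

variable {δ : V → V → ℕ} {A₀ E P C Q : Set V} {i : ℕ} {c : ℕ → V} {v b : V}

theorem one_lt_dist_segment (hG : G.Connected) (hδ : IsLocallyBipartite G δ)
    (hR : IsRope G δ A₀ i c E P) (hQ : IsFlexibleSegment G E (12 - i) (c i) v b C Q)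
    (hi : i ≤ 12) (hv : ∀ j ≤ i, 100 < δ (c j) v) {y q : V} (hy : y ∈ P) (hyc : y ≠ c i)
    (hq : q ∈ Q) (hqc : q ≠ c i) : 1 < G.dist y q := by
  have hv' : ∀ j ≤ i, 100 < G.dist (c j) v := fun j hj => (hv j hj).trans_le (hδ.le_dist _ _)
  rcases hQ.cover q hq with ⟨hqE, -⟩ | ⟨hq, w, hw, hwq⟩
  · exact dist_comm (G := G) ▸ hR.one_lt_dist q (hqE.resolve_left hqc) y hy hyc
  have hvq : G.dist q v ≤ 14 := by
    rw [dist_comm]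
    exact hq.elim le_of_lt fun h => h ▸ hQ.dist_joint.le
  have htri : G.dist y v ≤ G.dist y q + G.dist q v := hG.dist_triangle
  rcases hR.cover y hy with rfl | ⟨j, -, hj, hjy⟩ | ⟨-, h⟩
  · have := hv' 0 (Nat.zero_le _)
    omega
  · have := hv' j hj
    have := hG.dist_triangle (u := c j) (v := y) (w := v)
    omega
  · have := h w hw
    have := hG.dist_triangle (u := w) (v := q) (w := y)
    rw [dist_comm (u := q)] at this
    omega

theorem one_lt_dist_new (hG : G.Connected) (hδ : IsLocallyBipartite G δ)
    (hR : IsRope G δ A₀ i c E P) (hQ : IsFlexibleSegment G E (12 - i) (c i) v b C Q)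
    (hi : i ≤ 11) {x y : V} (hx : x ∈ C) (hy : y ∈ P ∪ Q) (hxc : 1 < δ (c i) x) (hyb : y ≠ b) :
    1 < G.dist x y := by
  have hxc : 1 < G.dist x (c i) := dist_comm (G := G) ▸ hxc.trans_le (hδ.le_dist _ _)
  rcases hy with hy | hy
  · by_cases h : y = c i
    · exact h ▸ hxc
    · exact hR.one_lt_dist x (hQ.subset hx) y hy h
  · rcases hQ.cover y hy with ⟨-, h⟩ | ⟨h, -⟩
    · have := h x hx
      omega
    · have := h.resolve_right hyb
      have := hQ.lt_dist x hx
      have := hG.dist_triangle (u := v) (v := y) (w := x)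
      rw [dist_comm (u := y)] at this
      omega

theorem cover_new (hG : G.Connected) (hR : IsRope G δ A₀ i c E P)
    (hQ : IsFlexibleSegment G E (12 - i) (c i) v b C Q) {y : V} (hy : y ∈ P ∪ Q) :
    y = c 0 ∨ (∃ j, 1 ≤ j ∧ j ≤ i ∧ G.dist (c j) y ≤ 28) ∨ G.dist b y ≤ 28 ∨
      (y ∈ A₀ ∧ ∀ x ∈ C, 12 - i < G.dist x y) := by
  rcases hy with hy | hy
  · refine (hR.cover y hy).imp_right (Or.imp_right fun ⟨hyA, h⟩ => Or.inr ⟨hyA, fun x hx => ?_⟩)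
    have := h x (hQ.subset hx)
    omega
  rcases hQ.cover y hy with ⟨rfl | hyE, h⟩ | ⟨h, -⟩
  · rcases Nat.eq_zero_or_pos i with rfl | hi
    · exact Or.inl rfl
    · exact Or.inr (Or.inl ⟨i, hi, le_rfl, by simp⟩)
  · exact Or.inr (Or.inr (Or.inr ⟨hR.subset hyE, h⟩))
  · have htri : G.dist b y ≤ G.dist b v + G.dist v y := hG.dist_triangle
    rw [dist_comm (v := v), hQ.dist_joint] at htri
    rcases h with h | rfl
    · exact Or.inr (Or.inr (Or.inl (by omega)))
    · simp

theorem snoc (hG : G.Connected) (hδ : IsLocallyBipartite G δ) (hR : IsRope G δ A₀ i c E P)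
    (hQ : IsFlexibleSegment G E (12 - i) (c i) v b C Q) (hi : i ≤ 11)
    (hv : ∀ j ≤ i, 100 < δ (c j) v) (hC : ∀ x ∈ C, 1 < δ (c i) x) :
    IsRope G δ A₀ (i + 1) (Function.update c (i + 1) b) C (P ∪ Q) := by
  have hc : ∀ j ≤ i, Function.update c (i + 1) b j = c j := fun j hj =>
    Function.update_of_ne (by omega) _ _
  refine ⟨hQ.connected, hQ.subset.trans hR.subset, by simpa using hQ.attached, ?_, ?_, ?_, ?_,
    fun π hπ => ?_⟩
  · rw [Function.update_self]
    exact fun x hx y hy hyb => hR.one_lt_dist_new hG hδ hQ hi hx hy (hC x hx) hyb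
  · intro y hy
    rw [hc 0 (Nat.zero_le i)]
    refine (hR.cover_new hG hQ hy).imp_right ?_
    rintro (⟨j, hj, hji, hjy⟩ | hby | ⟨hyA, h⟩)
    · exact Or.inl ⟨j, hj, by omega, by rwa [hc j hji]⟩
    · exact Or.inl ⟨i + 1, by omega, le_rfl, by rwa [Function.update_self]⟩
    · exact Or.inr ⟨hyA, fun x hx => by have := h x hx; omega⟩
  · intro j hj hji
    rcases hji.lt_or_eq with hji | rfl
    · exact hc j (by omega) ▸ hR.joint_mem j hj (by omega)
    · exact (Function.update_self (i + 1) b c).symm ▸ hR.subset hQ.joint_mem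
  · intro j j' hj hj'
    rw [hc j (by omega)]
    rcases hj'.lt_or_eq with hj' | rfl
    · exact hc j' (by omega) ▸ hR.lt_joint j j' hj (by omega)
    · have := hv j (by omega)
      have := hδ.le_add_dist (c j) b v
      rw [SimpleGraph.dist_comm, hQ.dist_joint] at this
      rw [Function.update_self]
      omega
  · obtain ⟨o, p, ho⟩ := hR.exists_isStrand π hπ
    obtain ⟨m, τ, hτ, h0, rfl, hτQ, heven⟩ := hQ.isFlexible (π i + π (i + 1))
    have hm : 0 < m := by
      refine Nat.pos_of_ne_zero fun hm => ?_
      have := (hv i le_rfl).trans_le (hδ.le_dist _ _)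
      rw [SimpleGraph.dist_comm, ← h0, ← hm, hQ.dist_joint] at this
      omega
    exact ⟨_, _, ho.snoc hτ h0 hm hτQ heven fun y hy hyc q hq hqc =>
      ne_and_not_adj_of_one_lt_dist (hR.one_lt_dist_segment hG hδ hQ (by omega) hv hy hyc hq hqc)⟩

theorem exists_snoc (hG : G.Connected) (hδ : IsLocallyBipartite G δ) (hR : IsRope G δ A₀ i c E P)
    (hi : i ≤ 4) {n : ℕ} (hcol : ¬ (G.induce E).Colorable (2 * n + 16)) :
    ∃ (b : V) (E' P' : Set V), IsRope G δ A₀ (i + 1) (Function.update c (i + 1) b) E' P' ∧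
      ¬ (G.induce E').Colorable n := by
  have hcol' : ¬ (G.induce E).Colorable (2 * (n + 3) + 2 * (i + 1)) := fun h =>
    hcol (h.mono (by omega))
  have hlt : ∀ x ∉ {x | ∃ j ≤ i, δ (c j) x ≤ 100}, ∀ j ≤ i, 100 < δ (c j) x := fun x hx j hj =>
    not_le.1 fun h => hx ⟨j, hj, h⟩
  have hfar : ∀ x ∉ {x | ∃ j ≤ i, δ (c j) x ≤ 100}, 14 < G.dist x (c i) := fun x hx => by
    have := (hlt x hx i le_rfl).trans_le (hδ.le_dist _ _)
    rw [SimpleGraph.dist_comm]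
    omega
  obtain ⟨v, b, C, Q, hQ, hv, hC, hCcol⟩ := exists_isFlexibleSegment hG hδ (ρ := 12 - i)
    hR.connected hR.attached (by omega) (by omega) (hδ.colorable_iUnion_ball c i) hfar hcol'
  exact ⟨b, C, P ∪ Q, hR.snoc hG hδ hQ (by omega) (hlt v hv) fun x hx =>
    (hlt x (hC x hx) i le_rfl).trans' (by omega), hCcol⟩

end IsRope

theorem exists_isRope_five (hG : G.Connected) {δ : V → V → ℕ} (hδ : IsLocallyBipartite G δ)
    {A₀ : Set V} {c₀ : V} (hA₀ : (G.induce A₀).Connected) (hc₀ : ∃ x ∈ A₀, G.Adj c₀ x)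
    (hcol : ¬ (G.induce A₀).Colorable 880) :
    ∃ (c : ℕ → V) (E P : Set V), IsRope G δ A₀ 5 c E P ∧ c 0 = c₀ ∧
      ¬ (G.induce E).Colorable 12 := by
  have hrope : ∀ i ≤ 5, ∃ (c : ℕ → V) (E P : Set V), IsRope G δ A₀ i c E P ∧ c 0 = c₀ ∧
      ¬ (G.induce E).Colorable (28 * 2 ^ (5 - i) - 16) := by
    intro i hi
    induction i with
    | zero => exact ⟨_, _, _, isRope_zero hA₀ hc₀, rfl, by simpa using hcol⟩
    | succ i ih =>
      obtain ⟨c, E, P, hR, h0, hE⟩ := ih (by omega)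
      rw [show 5 - i = 5 - (i + 1) + 1 by omega, pow_succ] at hE
      have hpos := Nat.two_pow_pos (5 - (i + 1))
      obtain ⟨b, E', P', hR', hE'⟩ := hR.exists_snoc hG hδ (by omega)
        (n := 28 * 2 ^ (5 - (i + 1)) - 16) fun h => hE (h.mono (by omega))
      exact ⟨_, E', P', hR', by simpa using h0, hE'⟩
  simpa using hrope 5 le_rfl

/-- The graph `G` has an induced odd cycle on which `x`, `y` and `z` cut off odd arcs. -/
def HasOddCycleThrough (G : SimpleGraph V) (x y z : V) : Prop :=
  ∃ (o : ℕ → V) (N p q r : ℕ), IsInducedCycle G o N ∧ Odd N ∧ p < q ∧ q < r ∧ r < N ∧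
    Odd (q - p) ∧ Odd (r - q) ∧ o p = x ∧ o q = y ∧ o r = z

namespace IsRope

variable {δ : V → V → ℕ} {A₀ E P : Set V} {c : ℕ → V} {i : ℕ} {z v w x y : V} {k : ℕ}

theorem one_lt_dist_geodesic (hG : G.Connected) (hR : IsRope G δ A₀ i c E P)
    (hA₀ : ∀ x ∈ A₀, G.dist z x = k) (hx : G.dist y x + G.dist x z ≤ k)
    (hy : ∀ j, 1 ≤ j → j ≤ i → 58 < G.dist y (c j)) (hw : w ∈ P) (hw0 : w ≠ c 0)
    (hyw : w ∈ A₀ → (∀ x ∈ E, 13 - i < G.dist x w) → 2 < G.dist y w) : 1 < G.dist x w := by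
  by_contra! hxw
  have hyxw : G.dist y w ≤ G.dist y x + G.dist x w := hG.dist_triangle
  have hzxw : G.dist z w ≤ G.dist z x + G.dist x w := hG.dist_triangle
  rw [dist_comm (v := x)] at hzxw
  rcases (hR.cover w hw).resolve_left hw0 with ⟨j, hj, hji, hjw⟩ | ⟨hwA, h⟩
  · have := hy j hj hji
    have := hA₀ (c j) (hR.joint_mem j hj hji)
    have hzwc : G.dist z (c j) ≤ G.dist z w + G.dist w (c j) := hG.dist_triangle
    have hywc : G.dist y (c j) ≤ G.dist y w + G.dist w (c j) := hG.dist_triangle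
    rw [dist_comm (u := w)] at hzwc hywc
    omega
  · have := hyw hwA h
    have := hA₀ w hwA
    omega

theorem one_lt_dist_of_dist_lt (hG : G.Connected) (hR : IsRope G δ A₀ i c E P)
    (hA₀ : ∀ x ∈ A₀, 14 < G.dist v x) (hv : ∀ j, 1 ≤ j → j ≤ i → 58 < G.dist v (c j))
    (hx : G.dist v x < 14) (hw : w ∈ P) (hw0 : w ≠ c 0) : 1 < G.dist x w := by
  have hvxw : G.dist v w ≤ G.dist v x + G.dist x w := hG.dist_triangle
  rcases (hR.cover w hw).resolve_left hw0 with ⟨j, hj, hji, hjw⟩ | ⟨hwA, -⟩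
  · have := hv j hj hji
    have hvwc : G.dist v (c j) ≤ G.dist v w + G.dist w (c j) := hG.dist_triangle
    rw [dist_comm (u := w)] at hvwc
    omega
  · have := hA₀ w hwA
    omega

theorem exists_return_set (hG : G.Connected) (hR : IsRope G δ A₀ i c E P) (hi : i ≤ 5)
    (hA₀ : ∀ x ∈ A₀, G.dist z x = k ∧ 14 < G.dist v x) (hvz : G.dist v z = k)
    (hvc : G.dist v (c 0) = 14) (hv : ∀ j, 1 ≤ j → j ≤ i → 58 < G.dist v (c j)) (hyE : y ∈ E)
    (hy : ∀ j, 1 ≤ j → j ≤ i → 58 < G.dist y (c j)) :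
    ∃ Z : Set V, (G.induce Z).Connected ∧ c i ∈ Z ∧ c 0 ∈ Z ∧
      ∀ x ∈ Z, x ≠ c i → x ≠ c 0 → ∀ w ∈ P, w ≠ c i → w ≠ c 0 → 1 < G.dist x w := by
  have hyz : G.dist y z = k := dist_comm.trans (hA₀ y (hR.subset hyE)).1
  obtain ⟨p, hp⟩ := exists_geodesic_support hG y z
  obtain ⟨q, hq⟩ := exists_geodesic_support hG v z
  obtain ⟨r, hr⟩ := exists_geodesic_support hG v (c 0)
  let s := (p.append q.reverse).append r
  refine ⟨insert (c i) E ∪ {x | x ∈ s.support}, ?_, by simp, by simp [s], ?_⟩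
  · exact induce_union_connected (connected_induce_insert hR.connected hR.attached).preconnected
      s.connected_induce_support.preconnected ⟨y, Or.inr hyE, s.start_mem_support⟩
  intro x hx hxi hx0 w hw hwi hw0
  rcases hx with (rfl | hxE) | hx
  · exact absurd rfl hxi
  · exact hR.one_lt_dist x hxE w hw hwi
  simp only [s, Set.mem_ofPred_eq, Walk.mem_support_append_iff, Walk.support_reverse,
    List.mem_reverse] at hx
  rcases hx with (hx | hx) | hx
  · exact hR.one_lt_dist_geodesic hG (fun x hx => (hA₀ x hx).1) ((hp x hx).trans hyz).le hy hw hw0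
      fun _ h => (h y hyE).trans' (by omega)
  · exact hR.one_lt_dist_geodesic hG (fun x hx => (hA₀ x hx).1) ((hq x hx).trans hvz).le hv hw hw0
      fun hwA _ => (hA₀ w hwA).2.trans' (by omega)
  · refine hR.one_lt_dist_of_dist_lt hG (fun x hx => (hA₀ x hx).2) hv ?_ hw hw0
    have := hr x hx
    have := hG.pos_dist_of_ne hx0
    omega

theorem hasOddCycleThrough (hR : IsRope G δ A₀ i c E P) {Z : Set V}
    (hZ : (G.induce Z).Connected) (hci : c i ∈ Z) (hc0 : c 0 ∈ Z)
    (hPZ : ∀ x ∈ Z, x ≠ c i → x ≠ c 0 → ∀ w ∈ P, w ≠ c i → w ≠ c 0 → 1 < G.dist x w)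
    (hfar : 1 < G.dist (c 0) (c i)) {a b d : ℕ} (ha : 1 ≤ a) (hab : a < b) (hbd : b < d)
    (hd : d ≤ i) : HasOddCycleThrough G (c a) (c b) (c d) := by
  obtain ⟨m, ζ, hζ, hζ0, hζm, hζZ⟩ := exists_isInducedPath hZ.preconnected hci hc0
  obtain ⟨o, p, ho⟩ := hR.exists_isStrand (fun j => if j = 0 then 0 else
    1 + m + (if a < j then 1 else 0) + (if b < j then 1 else 0)) (by simp)
  have hm : 2 ≤ m := by
    by_contra! hm
    obtain ⟨hne, hadj⟩ := ne_and_not_adj_of_one_lt_dist hfar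
    rw [← hζ0, ← hζm] at hne hadj
    interval_cases m
    · exact hne rfl
    · exact hadj ((hζ.adj_iff 0 1 (by omega) le_rfl).2 rfl).symm
  have hlt : ∀ j j', j < j' → j' ≤ i → p j < p j' := fun j j' hj hj' =>
    ho.strictMonoOn (hj.le.trans hj') hj' hj
  have ho0 : o 0 = c 0 := (congrArg o ho.start).symm.trans (ho.joint 0 (Nat.zero_le i))
  have hoi : o (p i) = c i := ho.joint i le_rfl
  have hcycle := ho.isInducedPath.close hζ (hoi.trans hζ0.symm) (hζm.trans ho0.symm)
    (Nat.one_le_of_lt (hlt 0 i (by omega) le_rfl)) hm fun j hj hji l hl hlm => by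
      obtain ⟨hne, hadj⟩ := ne_and_not_adj_of_one_lt_dist <|
        hPZ (ζ l) (hζZ l hlm.le) (hζ0 ▸ (hζ.ne 0 l hl hlm.le).symm) (hζm ▸ hζ.ne l m hlm le_rfl)
          (o j) (ho.mem j hji.le) (hoi ▸ ho.isInducedPath.ne j _ hji le_rfl)
          (ho0 ▸ (ho.isInducedPath.ne 0 j hj hji.le).symm)
      exact ⟨hne.symm, fun h => hadj h.symm⟩
  have hpa := ho.even a (by omega)
  have hpb := ho.even b (by omega)
  have hpd := ho.even d hd
  have hpi := ho.even i le_rfl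
  have hab' := hlt a b hab (by omega)
  have hbd' := hlt b d hbd hd
  have hdi := ho.strictMonoOn.monotoneOn hd Set.self_mem_Iic hd
  refine ⟨_, p i + m, p a, p b, p d, hcycle, ?_, hab', hbd', by omega, ?_, ?_, ?_, ?_, ?_⟩
  · grind
  · grind
  · grind
  · rw [if_pos (by omega), ho.joint a (by omega)]
  · rw [if_pos (by omega), ho.joint b (by omega)]
  · rw [if_pos (by omega), ho.joint d hd]

end IsRope

theorem exists_joints (hG : G.Connected) {δ : V → V → ℕ} (hδ : IsLocallyBipartite G δ)
    (hcol : ¬ G.Colorable 1764) :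
    ∃ c : ℕ → V, (∀ j j', j < j' → j' ≤ 5 → 86 < δ (c j) (c j')) ∧
      ∀ a b d, 1 ≤ a → a < b → b < d → d ≤ 5 → HasOddCycleThrough G (c a) (c b) (c d) := by
  obtain ⟨z⟩ := hG.nonempty
  obtain ⟨k, hk⟩ := exists_fibre_not_colorable (n := 882) (X := Set.univ) (f := G.dist z)
    (fun x _ y _ hxy => by have := hxy.diff_dist_adj (u := z); omega)
    fun h => hcol (h.of_hom (induceUnivIso G).symm.toHom)
  obtain ⟨E₀, hE₀, hE₀conn, hE₀col, -⟩ := exists_component_not_colorable hk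
  obtain ⟨v, hv⟩ := nonempty_of_not_colorable_induce hE₀col
  obtain ⟨A₀, hA₀, hA₀conn, hA₀col, hlt, c₀, -, hvc₀, hc₀⟩ :=
    exists_component_outside_ball (n := 880) (m := 2) hG hE₀conn hE₀col
      (hδ.colorable_dist_ball (r := 14) (by omega) v) hv
  obtain ⟨c, E, P, hR, rfl, hE⟩ := exists_isRope_five hG hδ hA₀conn hc₀ hA₀col
  obtain ⟨y, hyE, hy⟩ := nonempty_of_not_colorable_induce
    (not_colorable_induce_diff (n := 0) hE (hδ.colorable_iUnion_ball c 5))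
  have hfar : ∀ j, 1 ≤ j → j ≤ 5 → 86 < G.dist (c 0) (c j) := fun j hj hj5 =>
    (hR.lt_joint 0 j hj hj5).trans_le (hδ.le_dist _ _)
  have hvc : ∀ j, 1 ≤ j → j ≤ 5 → 58 < G.dist v (c j) := fun j hj hj5 => by
    have := hfar j hj hj5
    have htri : G.dist (c 0) (c j) ≤ G.dist (c 0) v + G.dist v (c j) := hG.dist_triangle
    rw [dist_comm (v := v)] at htri
    omega
  have hyc : ∀ j, 1 ≤ j → j ≤ 5 → 58 < G.dist y (c j) := fun j _ hj5 => by
    have : ¬ δ (c j) y ≤ 100 := fun h => hy ⟨j, hj5, h⟩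
    have := hδ.le_dist (c j) y
    rw [dist_comm]
    omega
  obtain ⟨Z, hZ, hc5, hc0, hPZ⟩ := hR.exists_return_set hG le_rfl
    (fun x hx => ⟨(hE₀ (hA₀ hx)).2, hlt x hx⟩) (dist_comm.trans (hE₀ hv).2) hvc₀ hvc hyE hyc
  exact ⟨c, hR.lt_joint, fun a b d ha hab hbd hd => hR.hasOddCycleThrough hZ hc5 hc0 hPZ
    ((hfar 5 (by omega) le_rfl).trans' (by omega)) ha hab hbd hd⟩

/-! ### Connected bipartite subgraphs through given vertices -/

theorem exists_isPath_even_add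
    (hG : ∀ (w : V) (c : G.Walk w w), c.IsCycle → Even c.length) {u v : V} (p : G.Walk u v) :
    ∃ q : G.Walk u v, q.IsPath ∧ Even (p.length + q.length) := by
  classical
  induction p with
  | nil => exact ⟨.nil, .nil, by simp⟩
  | @cons u v w huv p ih =>
    obtain ⟨q, hq, hpq⟩ := ih
    by_cases hu : u ∈ q.support
    · let c : G.Walk u u := .cons huv (q.takeUntil u hu)
      have hc : Even c.length := by
        by_cases h3 : 3 ≤ c.length
        · exact hG u c (Walk.isCycle_iff_isPath_tail_and_le_length.2
            ⟨by simpa [c] using hq.takeUntil hu, h3⟩)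
        · have h1 : c.length ≠ 1 := fun h => (Walk.adj_of_length_eq_one h).ne rfl
          have hpos : 0 < c.length := by simp [c]
          rw [show c.length = 2 by omega]
          exact even_two
      refine ⟨q.dropUntil u hu, hq.dropUntil hu, ?_⟩
      have hq_length := congrArg Walk.length (q.take_spec hu)
      simp only [Walk.length_append] at hq_length
      simp only [c, Walk.length_cons] at hc ⊢
      grind
    · exact ⟨.cons huv q, hq.cons hu, by simp only [Walk.length_cons]; grind⟩

theorem exists_isCycle_odd_of_not_colorable_two (hG : ¬ G.Colorable 2) :
    ∃ (u : V) (c : G.Walk u u), c.IsCycle ∧ Odd c.length := by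
  contrapose! hG
  simp only [Nat.not_odd_iff_even] at hG
  refine two_colorable_iff_forall_loop_even.2 fun u p => ?_
  obtain ⟨q, hq, hpq⟩ := exists_isPath_even_add hG p
  simpa [Walk.length_eq_zero_iff.2 (Walk.isPath_iff_nil.1 hq)] using hpq

theorem connected_induce_support_diff {u : V} {c : G.Walk u u} (hc : c.IsCycle) {x : V}
    (hx : x ∈ c.support) : (G.induce ({y | y ∈ c.support} \ {x})).Connected := by
  classical
  let d := c.rotate x hx
  have hd : d.IsCycle := hc.rotate hx
  have hlen := Walk.length_tail_add_one hd.not_nil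
  have htail : ¬ d.tail.Nil := fun h => by
    have := hd.three_le_length
    have := Walk.length_eq_zero_iff.2 h
    omega
  have hnodup := hd.isPath_tail.support_nodup
  rw [← Walk.support_dropLast_concat htail] at hnodup
  have hsupp : {y | y ∈ c.support} \ {x} = {y | y ∈ d.tail.dropLast.support} := by
    ext y
    rw [Set.mem_sdiff, Set.mem_ofPred_eq, ← c.mem_support_rotate_iff x hx,
      ← Walk.cons_support_tail hd.not_nil, ← Walk.support_dropLast_concat htail]
    simp only [List.nodup_append, List.mem_cons, List.mem_append, List.not_mem_nil, or_false,
      Set.mem_singleton_iff, Set.mem_ofPred_eq] at hnodup ⊢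
    grind
  rw [hsupp]
  exact d.tail.dropLast.connected_induce_support

/-- The branch at `y ∈ C` consists of the vertices that a walk from `y` reaches without meeting the
set `C` again. -/
def branch (G : SimpleGraph V) (C : Set V) (y : V) : Set V :=
  {x | ∃ p : G.Walk y x, ∀ z ∈ p.support, z ∈ C → z = y}

theorem exists_mem_branch (hG : G.Connected) {C : Set V} (hC : C.Nonempty) (x : V) :
    ∃ y ∈ C, x ∈ branch G C y := by
  obtain ⟨u, hu⟩ := hC
  obtain ⟨p⟩ := hG x u
  induction p with
  | nil => exact ⟨_, hu, .nil, by simp⟩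
  | @cons x v u hxv _ ih =>
    by_cases hx : x ∈ C
    · exact ⟨x, hx, .nil, by simp⟩
    · obtain ⟨y, hy, q, hq⟩ := ih hu
      refine ⟨y, hy, q.concat hxv.symm, fun z hz hzC => ?_⟩
      rw [Walk.support_concat, List.mem_append, List.mem_singleton] at hz
      exact hz.elim (hq z · hzC) fun h => absurd (h ▸ hzC) hx

theorem connected_induce_iUnion_branch {C D : Set V} (hD : (G.induce D).Connected) :
    (G.induce (⋃ y ∈ D, branch G C y)).Connected := by
  classical
  have hsub : D ⊆ ⋃ y ∈ D, branch G C y := fun y hy => Set.mem_biUnion hy ⟨.nil, by simp⟩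
  obtain ⟨u, hu⟩ := hD.nonempty
  refine induce_connected_of_patches u (hsub hu) fun {x} hx => ?_
  obtain ⟨y, hy, p, hp⟩ := Set.mem_iUnion₂.1 hx
  refine ⟨D ∪ {z | z ∈ p.support}, Set.union_subset hsub fun z hz => Set.mem_biUnion hy
    ⟨p.takeUntil z hz, fun w hw => hp w (p.support_takeUntil_subset_support hz hw)⟩, Or.inl hu,
    Or.inr p.end_mem_support, ?_⟩
  exact (induce_union_connected hD.preconnected p.connected_induce_support.preconnected
    ⟨y, hy, p.start_mem_support⟩).preconnected _ _

/-- If no smaller connected set contains the vertices `g j`, then deleting a vertex of a cycle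
separates one of them from the rest of the cycle. -/
theorem length_le_of_isCycle {n : ℕ} (hG : G.Connected) {g : Fin n → V}
    (hmin : ∀ X : Set V, (G.induce X).Connected → (∀ j, g j ∈ X) → X = Set.univ) {u : V}
    {c : G.Walk u u} (hc : c.IsCycle) : c.length ≤ n := by
  let C : Set V := {y | y ∈ c.support}
  have hcut : ∀ y ∈ C, ∃ j, ∀ z ∈ C, g j ∈ branch G C z → z = y := by
    intro y hy
    by_contra! hcon
    have huniv := hmin (⋃ z ∈ C \ {y}, branch G C z)
      (connected_induce_iUnion_branch (connected_induce_support_diff hc hy)) fun j => by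
        obtain ⟨z, hz, hj, hzy⟩ := hcon j
        exact Set.mem_biUnion ⟨hz, hzy⟩ hj
    obtain ⟨z, hz, p, hp⟩ := Set.mem_iUnion₂.1 (huniv ▸ Set.mem_univ y)
    exact hz.2 (hp y p.end_mem_support hy).symm
  have : Nonempty (Fin n) := ⟨(hcut u c.start_mem_support).choose⟩
  choose! φ hφ using hcut
  have hinj : Set.InjOn φ C := by
    intro y hy y' hy' hyy'
    obtain ⟨z, hz, hzφ⟩ := exists_mem_branch hG ⟨y, hy⟩ (g (φ y))
    exact (hφ y hy z hz hzφ).symm.trans (hφ y' hy' z hz (hyy' ▸ hzφ))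
  have hnodup : (c.support.tail.map φ).Nodup := hc.support_nodup.map_on fun y hy y' hy' =>
    hinj (List.mem_of_mem_tail hy) (List.mem_of_mem_tail hy')
  simpa using hnodup.length_le_card

theorem exists_connected_colorable_two [Finite V] {n : ℕ} (hodd : OddGirthGE G (n + 1))
    {T : Set V} (hT : (G.induce T).Connected) {g : Fin n → V} (hg : ∀ j, g j ∈ T) :
    ∃ H ⊆ T, (G.induce H).Connected ∧ (∀ j, g j ∈ H) ∧ (G.induce H).Colorable 2 := by
  obtain ⟨H, ⟨hHT, hH, hgH⟩, hmin⟩ := (Set.toFinite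
    {H : Set V | H ⊆ T ∧ (G.induce H).Connected ∧ ∀ j, g j ∈ H}).exists_minimal
    ⟨T, subset_rfl, hT, hg⟩
  refine ⟨H, hHT, hH, hgH, ?_⟩
  by_contra hcol
  obtain ⟨u, c, hc, hc_odd⟩ := exists_isCycle_odd_of_not_colorable_two hcol
  have hle : n + 1 ≤ c.length := hodd.induce H u c hc_odd
  refine hle.not_gt (Nat.lt_succ_of_le (length_le_of_isCycle hH (g := fun j => ⟨g j, hgH j⟩)
    (fun X hX hgX => ?_) hc))
  let φ : (G.induce H).induce X →g G.induce (Subtype.val '' X) :=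
    ⟨fun x => ⟨x.1, x.1, x.2, rfl⟩, id⟩
  have hφ : Function.Surjective φ := by
    rintro ⟨_, x, hx, rfl⟩
    exact ⟨⟨x, hx⟩, rfl⟩
  have hXH : Subtype.val '' X ⊆ H := by simp
  have hHX : H ⊆ Subtype.val '' X :=
    hmin ⟨hXH.trans hHT, hX.map φ hφ, fun j => ⟨_, hgX j, rfl⟩⟩ hXH
  exact Set.eq_univ_of_forall fun x => by simpa using hHX x.2

/-- Vertices `c j` at distance `s` from `z` hang on a connected set `T` inside the ball of radius
`s - 2` around `z`: the hook `h j` joins `c j` to its only neighbour `g j` in `T`, and the hooks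
are pairwise nonadjacent. -/
structure IsHanger {ι : Type*} (G : SimpleGraph V) (z : V) (s : ℕ) (c g h : ι → V) (T : Set V) :
    Prop where
  connected : (G.induce T).Connected
  dist_add_two_le : ∀ x ∈ T, G.dist z x + 2 ≤ s
  dist_hook : ∀ j, G.dist z (h j) + 1 = s
  mem : ∀ j, g j ∈ T
  adj_mem : ∀ j, G.Adj (h j) (g j)
  adj_top : ∀ j, G.Adj (h j) (c j)
  eq_of_adj : ∀ j, ∀ x ∈ T, G.Adj (h j) x → x = g j
  not_adj : ∀ j j', ¬ G.Adj (h j) (h j')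

theorem connected_induce_iUnion_support {ι : Type*} [Nonempty ι] {z : V} {v : ι → V}
    (p : ∀ j, G.Walk z (v j)) : (G.induce {x | ∃ j, x ∈ (p j).support}).Connected :=
  induce_connected_of_patches z ⟨Classical.arbitrary ι, (p _).start_mem_support⟩
    fun {_} ⟨j, hx⟩ => ⟨{y | y ∈ (p j).support}, fun _ hy => ⟨j, hy⟩, (p j).start_mem_support, hx,
      (p j).connected_induce_support.preconnected _ _⟩

theorem eq_of_adj_of_dist_le {ι : Type*} (hG : G.Connected) {c : ι → V}
    (hfar : ∀ j j', j ≠ j' → 4 < G.dist (c j) (c j')) {j j' : ι} {x y : V}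
    (hx : G.dist x (c j) ≤ 1) (hxy : G.Adj x y) (hy : G.dist y (c j') ≤ 2) : j = j' := by
  by_contra hne
  have := hfar j j' hne
  have h1 : G.dist (c j) (c j') ≤ G.dist (c j) x + G.dist x (c j') := hG.dist_triangle
  have h2 : G.dist x (c j') ≤ G.dist x y + G.dist y (c j') := hG.dist_triangle
  rw [dist_comm] at hx
  rw [dist_eq_one_iff_adj.2 hxy] at h2
  omega

theorem exists_isHanger {ι : Type*} [Nonempty ι] (hG : G.Connected) {z : V} {s : ℕ} (hs : 2 ≤ s)
    {c : ι → V} (hc : ∀ j, G.dist z (c j) = s)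
    (hfar : ∀ j j', j ≠ j' → 4 < G.dist (c j) (c j')) : ∃ g h T, IsHanger G z s c g h T := by
  choose p hp hdist using fun j => exists_geodesic (hG z (c j))
  simp only [hc] at hp
  simp only [hp] at hdist
  have hend (j) : (p j).getVert s = c j := hp j ▸ (p j).getVert_length
  have hclose (j) {i k : ℕ} (hi : i + k = s) : G.dist ((p j).getVert i) (c j) ≤ k :=
    (dist_le ((p j).drop i)).trans (by rw [Walk.drop_length, hp]; omega)
  have hT : ∀ x ∈ {x | ∃ j, x ∈ ((p j).take (s - 2)).support},
      ∃ j, ∃ i ≤ s - 2, x = (p j).getVert i ∧ G.dist z x = i := by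
    rintro x ⟨j, hx⟩
    obtain ⟨i, rfl, hi⟩ := Walk.mem_support_iff_exists_getVert.1 hx
    rw [Walk.take_length, hp] at hi
    rw [Walk.take_getVert, min_eq_right (by omega)]
    exact ⟨j, i, by omega, rfl, hdist j i (by omega)⟩
  have hadj (j) {i k : ℕ} (hi : i < s) (hk : i + 1 = k) :
      G.Adj ((p j).getVert k) ((p j).getVert i) :=
    hk ▸ ((p j).adj_getVert_succ (hp j ▸ hi)).symm
  have heq {j j' : ι} {x : V} (hx : G.Adj ((p j).getVert (s - 1)) x) (hxj' : G.dist x (c j') ≤ 2) :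
      j = j' :=
    eq_of_adj_of_dist_le hG hfar (hclose j (by omega)) hx hxj'
  refine ⟨fun j => (p j).getVert (s - 2), fun j => (p j).getVert (s - 1), _,
    connected_induce_iUnion_support fun j => (p j).take (s - 2), fun x hx => ?_, fun j => ?_,
    fun j => ⟨j, Walk.end_mem_support _⟩, fun j => hadj j (by omega) (by omega), fun j => ?_,
    fun j x hx hjx => ?_, fun j j' hjj' => ?_⟩
  · obtain ⟨_, i, hi, -, hxi⟩ := hT x hx
    omega
  · rw [hdist j _ (by omega)]
    omega
  · have := (hadj j (i := s - 1) (k := s) (by omega) (by omega)).symm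
    rwa [hend] at this
  · obtain ⟨j', i, hi, rfl, hxi⟩ := hT x hx
    have := hjx.diff_dist_adj (u := z)
    rw [hxi, hdist j _ (by omega)] at this
    obtain rfl : i = s - 2 := by omega
    rw [heq hjx (hclose j' (by omega))]
  · have := heq hjj' ((hclose j' (k := 1) (by omega)).trans one_le_two)
    exact hjj'.ne (by rw [this])

namespace IsHanger

variable {ι : Type*} {z : V} {s : ℕ} {c g h : ι → V} {T : Set V}

theorem mono (hT : IsHanger G z s c g h T) {H : Set V} (hHT : H ⊆ T)
    (hH : (G.induce H).Connected) (hgH : ∀ j, g j ∈ H) : IsHanger G z s c g h H where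
  connected := hH
  dist_add_two_le x hx := hT.dist_add_two_le x (hHT hx)
  dist_hook := hT.dist_hook
  mem := hgH
  adj_mem := hT.adj_mem
  adj_top := hT.adj_top
  eq_of_adj j x hx := hT.eq_of_adj j x (hHT hx)
  not_adj := hT.not_adj

theorem connected_union_hooks (hT : IsHanger G z s c g h T) (J : Set ι) :
    (G.induce (T ∪ h '' J)).Connected := by
  obtain ⟨u, hu⟩ := hT.connected.nonempty
  refine induce_connected_of_patches u (Or.inl hu) ?_
  rintro x (hx | ⟨j, hj, rfl⟩)
  · exact ⟨T, Set.subset_union_left, hu, hx, hT.connected.preconnected _ _⟩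
  · exact ⟨insert (h j) T, Set.insert_subset (Or.inr ⟨j, hj, rfl⟩) Set.subset_union_left,
      Or.inr hu, Or.inl rfl,
      (connected_induce_insert hT.connected ⟨_, hT.mem j, hT.adj_mem j⟩).preconnected _ _⟩

theorem isHub (hT : IsHanger G z s c g h T) {κ : V → Bool}
    (hκ : ∀ x ∈ T, ∀ y ∈ T, G.Adj x y → κ x ≠ κ y) {J : Set ι} {ε : Bool}
    (hJ : ∀ j ∈ J, κ (g j) = ε) {o : ℕ → V} {N : ℕ} (ho : ∀ i < N, G.dist z (o i) = s) :
    IsHub G o N {x ∈ T | κ x = ε} ({x ∈ T | κ x ≠ ε} ∪ h '' J) := by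
  have hhook : ∀ j ∈ J, ∀ x ∈ T, κ x ≠ ε → ¬ G.Adj (h j) x := fun j hj x hx hxε hjx =>
    hxε (hT.eq_of_adj j x hx hjx ▸ hJ j hj)
  refine ⟨?_, ?_, ?_, ?_, fun i hi hx => ?_, fun i hi hx => ?_, fun i hi x hx hxi => ?_⟩
  · exact fun x hx y hy _ hxy => hκ x hx.1 y hy.1 hxy (hx.2.trans hy.2.symm)
  · rintro x (hx | ⟨j, hj, rfl⟩) y (hy | ⟨j', hj', rfl⟩) _ hxy
    · exact hκ x hx.1 y hy.1 hxy ((Bool.eq_not.2 hx.2).trans (Bool.eq_not.2 hy.2).symm)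
    · exact hhook j' hj' x hx.1 hx.2 hxy.symm
    · exact hhook j hj y hy.1 hy.2 hxy
    · exact hT.not_adj j j' hxy
  · rw [Set.disjoint_left]
    rintro x hx (hx' | ⟨j, -, rfl⟩)
    · exact hx'.2 hx.2
    · have := hT.dist_add_two_le _ hx.1
      have := hT.dist_hook j
      omega
  · have hunion : {x ∈ T | κ x = ε} ∪ ({x ∈ T | κ x ≠ ε} ∪ h '' J) = T ∪ h '' J := by
      rw [← Set.union_assoc]
      congr 1
      ext x
      simp only [Set.mem_union, Set.mem_ofPred_eq]
      tauto
    rw [hunion]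
    exact (hT.connected_union_hooks J).preconnected
  · have := hT.dist_add_two_le _ hx.1
    have := ho i hi
    omega
  · have := ho i hi
    rcases hx with hx | ⟨j, -, hj⟩
    · have := hT.dist_add_two_le _ hx.1
      omega
    · have := hT.dist_hook j
      rw [hj] at this
      omega
  · have := hT.dist_add_two_le x hx.1
    have := ho i hi
    have := hxi.diff_dist_adj (u := z)
    omega

end IsHanger

theorem IsInducedCycle.of_induce {K : Set V} {o : ℕ → K} {N : ℕ}
    (ho : IsInducedCycle (G.induce K) o N) : IsInducedCycle G (fun i => (o i : V)) N where
  closed := congrArg _ ho.closed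
  injOn := Subtype.val_injective.injOn.comp ho.injOn (Set.mapsTo_univ _ _)
  adj_iff := ho.adj_iff

theorem false_of_hasOddCycleThrough [Finite V] (hG : G.tStab ⊆ G.stableSetPolytope)
    (hodd : OddGirthGE G 6) (hconn : G.Connected) {z : V} {s : ℕ} {K : Set V}
    (hK : ∀ x ∈ K, G.dist z x = s) {c : Fin 5 → K}
    (hfar : ∀ j j', j ≠ j' → 4 < G.dist (c j : V) (c j'))
    (hcycle : ∀ a b d, a < b → b < d → HasOddCycleThrough (G.induce K) (c a) (c b) (c d)) :
    False := by
  have hs : 2 ≤ s := by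
    have h1 := hfar 0 1 (by decide)
    have h2 := hconn.dist_triangle (u := (c 0 : V)) (v := z) (w := c 1)
    rw [SimpleGraph.dist_comm (v := z), hK _ (c 0).2, hK _ (c 1).2] at h2
    omega
  obtain ⟨g, h, T, hT⟩ := exists_isHanger hconn hs (fun j => hK _ (c j).2) hfar
  obtain ⟨H, hHT, hH, hgH, hcol⟩ := exists_connected_colorable_two (n := 5) hodd hT.connected hT.mem
  obtain ⟨κ, hκ⟩ := exists_ne_of_colorable_induce_two hcol
  have hpigeon : ∀ f : Fin 5 → Bool, ∃ a b d, a < b ∧ b < d ∧ f b = f a ∧ f d = f a := by decide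
  obtain ⟨a, b, d, hab, hbd, hb, hd⟩ := hpigeon fun j => κ (g j)
  obtain ⟨o, N, p, q, r, ho, hN, hpq, hqr, hr, hpq', hqr', hoa, hob, hod⟩ := hcycle a b d hab hbd
  have hhub := (hT.mono hHT hH hgH).isHub hκ (J := {a, b, d}) (ε := κ (g a)) (by simp [hb, hd])
    (o := fun i => (o i : V)) (N := N) fun i _ => hK _ (o i).2
  have hattach (j) (hj : j ∈ ({a, b, d} : Set (Fin 5))) {i : ℕ} (hi : o i = c j) :
      ∃ x ∈ {x ∈ H | κ x ≠ κ (g a)} ∪ h '' {a, b, d}, G.Adj x (o i) :=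
    ⟨h j, Or.inr ⟨j, hj, rfl⟩, hi ▸ hT.adj_top j⟩
  exact false_of_isHub hG hhub ho.of_induce hN hpq hqr hr hpq' hqr' (hattach a (by simp) hoa)
    (hattach b (by simp) hob) (hattach d (by simp) hod)

theorem OddGirthGE.colorable_dist_ball {n r : ℕ} (hodd : OddGirthGE G n) (hrn : 2 * r + 1 < n)
    (hG : G.Connected) (c : V) : (G.induce {x | G.dist c x ≤ r}).Colorable 2 := by
  refine colorable_induce_of_ne (fun x => (G.dist c x).bodd) fun x hx y _ hxy => ?_
  have hne : G.dist c x ≠ G.dist c y := fun heq => by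
    obtain ⟨p, hp, -⟩ := exists_closed_walk_of_dist_eq hG hxy heq
    have := hodd _ p (hp ▸ odd_two_mul_add_one _)
    have : G.dist c x ≤ r := hx
    omega
  have := hxy.diff_dist_adj (u := c)
  have : G.dist c y = G.dist c x + 1 ∨ G.dist c x = G.dist c y + 1 := by omega
  rcases this with h | h <;> simp [h]

theorem isLocallyBipartite_induce (hG : G.Connected) (hodd : OddGirthGE G 203) {K : Set V}
    (hK : (G.induce K).Connected) :
    IsLocallyBipartite (G.induce K) fun x y => G.dist (x : V) y := by
  have hle (x y : K) : G.dist (x : V) y ≤ (G.induce K).dist x y := by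
    obtain ⟨p, hp⟩ := hK.exists_walk_length_eq_dist x y
    exact (dist_le (p.map (Embedding.induce K).toHom)).trans_eq ((Walk.length_map _ _).trans hp)
  refine ⟨hle, fun x y z => hG.dist_triangle.trans (by grw [hle y z]), fun c => ?_⟩
  let φ : (G.induce K).induce {x : K | G.dist (c : V) x ≤ 100} →g
      G.induce {x : V | G.dist c x ≤ 100} :=
    ⟨fun x => ⟨x, x.2⟩, id⟩
  exact (hodd.colorable_dist_ball (by norm_num) hG c).of_hom φ

theorem colorable_of_connected [Finite V] (hG : G.tStab ⊆ G.stableSetPolytope)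
    (hodd : OddGirthGE G 203) (hconn : G.Connected) : G.Colorable (2 * 1764) := by
  by_contra hcol
  obtain ⟨z⟩ := hconn.nonempty
  obtain ⟨s, hs⟩ := exists_fibre_not_colorable (X := Set.univ) (f := G.dist z)
    (fun x _ y _ hxy => by have := hxy.diff_dist_adj (u := z); omega)
    fun h => hcol (h.of_hom (induceUnivIso G).symm.toHom)
  obtain ⟨K, hK, hKconn, hKcol, -⟩ := exists_component_not_colorable hs
  obtain ⟨c, hfar, hcycle⟩ :=
    exists_joints hKconn (isLocallyBipartite_induce hconn hodd hKconn) hKcol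
  refine false_of_hasOddCycleThrough hG (fun u p hp => (hodd u p hp).trans' (by norm_num)) hconn
    (fun x hx => (hK hx).2) (c := fun j => c (j + 1)) (fun j j' hjj' => ?_)
    fun a b d hab hbd => hcycle _ _ _ (by omega) (by omega) (by omega) (by omega)
  rcases lt_or_gt_of_ne hjj' with h | h
  · exact (hfar (j + 1) (j' + 1) (by omega) (by omega)).trans' (by norm_num)
  · rw [SimpleGraph.dist_comm]
    exact (hfar (j' + 1) (j + 1) (by omega) (by omega)).trans' (by norm_num)

theorem colorable_of_oddGirthGE [Finite V] (hG : G.tStab ⊆ G.stableSetPolytope)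
    (hodd : OddGirthGE G 203) : G.Colorable (2 * 1764) :=
  colorable_iff_forall_connectedComponent.2 fun C =>
    colorable_of_connected (tStab_subset_induce hG C.supp) (hodd.induce _)
      C.connected_toSimpleGraph

theorem colorable_of_tStab_subset [Finite V] (hG : G.tStab ⊆ G.stableSetPolytope) {k m : ℕ}
    (hk : 1 ≤ k) (hkm : k + m = 101) (hodd : OddGirthGE G (2 * k + 1)) :
    G.Colorable (2 * 1764 + m) := by
  induction m generalizing V k with
  | zero =>
    obtain rfl : k = 101 := hkm
    exact colorable_of_oddGirthGE hG hodd
  | succ m ih =>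
    obtain ⟨S, hS, hodd'⟩ := exists_isIndepSet_oddGirthGE_compl hG hk hodd
    have hSc := ih (tStab_subset_induce hG Sᶜ) (k := k + 1) (by omega) (by omega) hodd'
    have huniv := colorable_induce_union hSc (colorable_induce_one_of_isIndepSet hS)
    rw [Set.compl_union_self] at huniv
    exact huniv.of_hom (induceUnivIso G).symm.toHom

end TPerfect

theorem theorem1p1_general {V : Type*} [Finite V] (G : SimpleGraph V) (hG : G.IsTPerfect) :
    G.Colorable 3628 :=
  TPerfect.colorable_of_tStab_subset hG.ge (k := 1) (m := 100) le_rfl rfl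
    (TPerfect.OddGirthGE.three G)

theorem theorem1p1 {V : Type*} [Finite V] (G : SimpleGraph V) (hG : G.IsTPerfect) :
    G.Colorable 199053 := by
  exact (theorem1p1_general G hG).mono (by norm_num)
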